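/- Let $k$ be a field and $R$ a finite-dimensional (associative, unital) $k$-algebra. Write $\otimes_R$ for the tensor product of $R$-bimodules ($k$ acting symmetrically), and $R^{*}=\operatorname{Hom}_k(R,k)$. **Definitions.** * A *$\times_R$-bialgebra* is a $k$-algebra $B$ with $k$-algebra maps $s\colon R\to B$ and $t\colon R^{\mathrm{op}}\to B$ whose images commute, and with the structure of a coalgebra $(\Delta\colon B\to B\otimes_R B,\ \epsilon\colon B\to R)$ in the monoidal category of $R$-bimodules, where $B$ carries the bimodule structure $x.b.y=s(x)t(y)b$, such that: (i) $\Delta$ takes values in the Takeuchi product $\{\sum_i a_i\otimes c_i \mid \sum_i a_it(r)\otimes c_i=\sum_i a_i\otimes c_is(r)\ \forall r\in R\}\subseteq B\otimes_RB$; (ii) $\Delta$ is a unital algebra map into the Takeuchi product with its factorwise multiplication; (iii) $\epsilon(b\,s(\epsilon(b')))=\epsilon(bb')=\epsilon(b\,t(\epsilon(b')))$ for all $b,b'\in B$; (iv) $\epsilon(1)=1$. * A *full $R$-Hopf algebroid* is a $\times_R$-bialgebra $B$ with an *antipode*: an invertible $k$-linear anti-algebra map $S\colon B\to B$ with $S\circ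 t=s$ and, writing $\Delta(b)=b_{(1)}\otimes b_{(2)}$, $$S(b_{(1)})_{(1)}\,b_{(2)}\otimes S(b_{(1)})_{(2)}=1\otimes S(b),\qquad S^{-1}(b_{(2)})_{(1)}\otimes S^{-1}(b_{(2)})_{(2)}\,b_{(1)}=S^{-1}(b)\otimes 1$$ in $B\otimes_RB$ for all $b\in B$. * $B\text{-mod}^{\mathrm{fd}}$ is the monoidal category of finite-dimensional left $B$-modules: each module is an $R$-bimodule by $x.m.y=s(x)t(y)m$, the product is $M\otimes_RN$ with $b(m\otimes n)=b_{(1)}m\otimes b_{(2)}n$, and the unit is $R$ with $b\triangleright r=\epsilon(b\,s(r))$. Let $U\colon B\text{-mod}^{\mathrm{fd}}\to{}_R\mathrm{Mod}_R^{\mathrm{fd}}$ be the forgetful functor to finite-dimensional $R$-bimodules. * An object $K$ of a monoidal category is *dualizing* if for every object $Y$ the functor $\operatorname{Hom}(-\otimes Y,K)$ is representable by some object $DY$ and the induced contravariant functor $D$ is an antiequivalence. * A monoidal category is *closed* if all functors $X\otimes-$ and $-\otimes X$ have right adjoints (the internal homs). A monoidal functor $F$ between closed monoidal categories is *closed* if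 both canonical comparison maps from $F$ of an internal hom of $X,Y$ to the corresponding internal hom of $FX,FY$ are isomorphisms for all $X,Y$. It is *strict monoidal* if it preserves unit and tensor products on the nose, with identities as structure morphisms. **Statement.** Let $B$ be a full $R$-Hopf algebroid with antipode $S$. Then: 1. The formula $(b\blacktriangleright_S f)(r)=f(S(b)\triangleright r)=f(\epsilon(S(b)s(r)))$, for $b\in B$, $f\in R^{*}$, $r\in R$, makes $R^{*}$ a left $B$-module, and this module is a dualizing object of $B\text{-mod}^{\mathrm{fd}}$. 2. The categories $B\text{-mod}^{\mathrm{fd}}$ and ${}_R\mathrm{Mod}_R^{\mathrm{fd}}$ are closed monoidal, and $U$ is a strict monoidal closed functor. 3. The bimodule $U(R^{*},\blacktriangleright_S)$ is a dualizing object of ${}_R\mathrm{Mod}_R^{\mathrm{fd}}$. It is the space $R^{*}$ with the bimodule structure $$(z.f.x)(y)=f\bigl(x\cdot y\cdot \epsilon(S(s(z)))\bigr),\qquad x,y,z\in R,\ f\in R^{*}.$$ 4. The dual bimodule $R^{*}$ with its canonical structure $(z.f.x)(y)=f(x\cdot y\cdot z)$ is also a dualizing object of ${}_R\mathrm{Mod}_R^{\mathrm{fd}}$.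 It is equal to $U(R^{*},\blacktriangleright_S)$ if and only if $\epsilon(S(s(z)))=z$ for all $z\in R$. -/

import Mathlib

open CategoryTheory MonoidalCategory TensorProduct MulOpposite

universe u

noncomputable section

namespace HopfGV

/-- A left module over the `k`-algebra `A`: a `k`-vector space with a `k`-algebra map from `A` to
its endomorphisms. -/
structure AlgMod (k A : Type u) [Field k] [Ring A] [Algebra k A] where
  carrier : Type u
  [addCommGroup : AddCommGroup carrier]
  [module : Module k carrier]
  act : A →ₐ[k] Module.End k carrier

attribute [instance] AlgMod.addCommGroup AlgMod.module

namespace AlgMod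

section

variable {k A B : Type u} [Field k] [Ring A] [Algebra k A] [Ring B] [Algebra k B]

/-- `A`-linear maps. -/
@[ext]
structure Hom (V W : AlgMod k A) where
  lin : V.carrier →ₗ[k] W.carrier
  comm : ∀ a v, lin (V.act a v) = W.act a (lin v)

instance : Category (AlgMod k A) where
  Hom := Hom
  id V := ⟨LinearMap.id, fun _ _ => rfl⟩
  comp f g := ⟨g.lin ∘ₗ f.lin, fun a v => by simp [f.comm, g.comm]⟩

@[simp] theorem id_lin (V : AlgMod k A) : Hom.lin (𝟙 V) = LinearMap.id := rfl

@[simp] theorem comp_lin {V W X : AlgMod k A} (f : V ⟶ W) (g : W ⟶ X) :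
    Hom.lin (f ≫ g) = g.lin ∘ₗ f.lin := rfl

theorem hom_ext {V W : AlgMod k A} {f g : V ⟶ W} (h : f.lin = g.lin) : f = g := Hom.ext h

/-- An invertible `A`-linear map as an isomorphism. -/
@[simps]
def isoMk {V W : AlgMod k A} (f : V ⟶ W) (g : W ⟶ V) (h₁ : g.lin ∘ₗ f.lin = LinearMap.id)
    (h₂ : f.lin ∘ₗ g.lin = LinearMap.id) : V ≅ W where
  hom := f
  inv := g
  hom_inv_id := hom_ext h₁
  inv_hom_id := hom_ext h₂

/-- Restriction of scalars along an algebra map. -/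
@[simps]
def restrict (e : A →ₐ[k] B) : AlgMod k B ⥤ AlgMod k A where
  obj V := ⟨V.carrier, V.act.comp e⟩
  map f := ⟨f.lin, fun a v => f.comm (e a) v⟩

instance (e : A →ₐ[k] B) : (restrict e).Faithful where
  map_injective h := hom_ext (by have := congrArg Hom.lin h; exact this)

/-- The left regular module. -/
@[simps]
def regular (k A : Type u) [Field k] [Ring A] [Algebra k A] : AlgMod k A where
  carrier := A
  act := Algebra.lmul k A

end

end AlgMod

section Bimodules

variable {k R : Type u} [Field k] [Ring R] [Algebra k R]

/-- `R`-bimodules (with central action of `k`), as left modules over the enveloping algebra: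
`x ⊗ op y` acts as `v ↦ x.v.y`. -/
abbrev RBimod (k R : Type u) [Field k] [Ring R] [Algebra k R] := AlgMod k (R ⊗[k] Rᵐᵒᵖ)

/-- The `R`-bimodule with given commuting left and right actions. -/
@[simps]
def RBimod.ofActions (V : Type u) [AddCommGroup V] [Module k V] (l : R →ₐ[k] Module.End k V)
    (r : Rᵐᵒᵖ →ₐ[k] Module.End k V) (h : ∀ x y, Commute (l x) (r y)) : RBimod k R where
  carrier := V
  act := Algebra.TensorProduct.lift l r h

/-- The left action of `R` on an `R`-bimodule. -/
def RBimod.lact (V : RBimod k R) : R →ₐ[k] Module.End k V.carrier :=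
  V.act.comp Algebra.TensorProduct.includeLeft

/-- The right action of `R` on an `R`-bimodule. -/
def RBimod.ract (V : RBimod k R) : Rᵐᵒᵖ →ₐ[k] Module.End k V.carrier :=
  V.act.comp Algebra.TensorProduct.includeRight

theorem RBimod.commute (V : RBimod k R) (x : R) (y : Rᵐᵒᵖ) : Commute (V.lact x) (V.ract y) := by
  unfold RBimod.lact RBimod.ract
  simp only [AlgHom.comp_apply]
  exact Commute.map (by simp [Commute, SemiconjBy]) V.act

theorem RBimod.act_tmul (V : RBimod k R) (x : R) (y : Rᵐᵒᵖ) (v : V.carrier) :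
    V.act (x ⊗ₜ y) v = V.lact x (V.ract y v) := by
  simp only [RBimod.lact, RBimod.ract, AlgHom.comp_apply, ← Module.End.mul_apply, ← map_mul]
  simp

@[simp] theorem RBimod.hom_lact {V W : RBimod k R} (f : V ⟶ W) (x : R) (v : V.carrier) :
    f.lin (V.lact x v) = W.lact x (f.lin v) := f.comm _ _

@[simp] theorem RBimod.hom_ract {V W : RBimod k R} (f : V ⟶ W) (x : Rᵐᵒᵖ) (v : V.carrier) :
    f.lin (V.ract x v) = W.ract x (f.lin v) := f.comm _ _

theorem RBimod.lact_ofActions (V : Type u) [AddCommGroup V] [Module k V]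
    (l : R →ₐ[k] Module.End k V) (r : Rᵐᵒᵖ →ₐ[k] Module.End k V) (h) (x : R) (v : V) :
    (RBimod.ofActions V l r h).lact x v = l x v := by
  change Algebra.TensorProduct.lift l r h (x ⊗ₜ 1) v = l x v
  simp

theorem RBimod.ract_ofActions (V : Type u) [AddCommGroup V] [Module k V]
    (l : R →ₐ[k] Module.End k V) (r : Rᵐᵒᵖ →ₐ[k] Module.End k V) (h) (x : Rᵐᵒᵖ) (v : V) :
    (RBimod.ofActions V l r h).ract x v = r x v := by
  change Algebra.TensorProduct.lift l r h (1 ⊗ₜ x) v = r x v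
  simp

/-- A linear map commuting with the left and right actions is a map of bimodules. -/
@[simps]
def RBimod.homMk {V W : RBimod k R} (f : V.carrier →ₗ[k] W.carrier)
    (hl : ∀ x v, f (V.lact x v) = W.lact x (f v))
    (hr : ∀ x v, f (V.ract x v) = W.ract x (f v)) : V ⟶ W where
  lin := f
  comm a v := by
    induction a using TensorProduct.induction_on with
    | zero => simp
    | tmul x y => simp [RBimod.act_tmul, hl, hr]
    | add a b ha hb => simp [ha, hb]

/-- The relations `v.r ⊗ w = v ⊗ r.w` of the tensor product over `R`. -/
def balRel (V W : RBimod k R) : Submodule k (V.carrier ⊗[k] W.carrier) :=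
  Submodule.span k {x | ∃ (r : R) (v : V.carrier) (w : W.carrier),
    x = V.ract (op r) v ⊗ₜ w - v ⊗ₜ W.lact r w}

/-- The underlying vector space of `V ⊗_R W`. -/
abbrev BT (V W : RBimod k R) : Type u := (V.carrier ⊗[k] W.carrier) ⧸ balRel V W

theorem balRel_map_l (V W : RBimod k R) (x : R) :
    balRel V W ≤ (balRel V W).comap (LinearMap.rTensor W.carrier (V.lact x)) :=
  Submodule.span_le.2 (by
    rintro _ ⟨r, v, w, rfl⟩
    refine Submodule.subset_span ⟨r, V.lact x v, w, ?_⟩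
    have := LinearMap.congr_fun (RBimod.commute V x (op r)) v
    simp only [Module.End.mul_apply] at this
    simp [this])

theorem balRel_map_r (V W : RBimod k R) (x : Rᵐᵒᵖ) :
    balRel V W ≤ (balRel V W).comap (LinearMap.lTensor V.carrier (W.ract x)) :=
  Submodule.span_le.2 (by
    rintro _ ⟨r, v, w, rfl⟩
    refine Submodule.subset_span ⟨r, v, W.ract x w, ?_⟩
    have := LinearMap.congr_fun (RBimod.commute W r x) w
    simp only [Module.End.mul_apply] at this
    simp [this])

theorem BT.ext {V W : RBimod k R} {Z : Type u} [AddCommGroup Z] [Module k Z]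
    {f g : BT V W →ₗ[k] Z}
    (h : ∀ v w, f ((balRel V W).mkQ (v ⊗ₜ w)) = g ((balRel V W).mkQ (v ⊗ₜ w))) : f = g :=
  Submodule.linearMap_qext _ (TensorProduct.ext' h)

/-- The left action of `R` on `V ⊗_R W`. -/
def BT.lact (V W : RBimod k R) : R →ₐ[k] Module.End k (BT V W) :=
  AlgHom.ofLinearMap
    { toFun x := (balRel V W).mapQ (balRel V W) (LinearMap.rTensor W.carrier (V.lact x))
        (balRel_map_l V W x)
      map_add' x y := BT.ext fun v w => by simp
      map_smul' c x := BT.ext fun v w => by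
        simp only [map_smul, LinearMap.smul_apply, Submodule.mapQ_apply, Submodule.mkQ_apply,
          LinearMap.rTensor_tmul, ← TensorProduct.smul_tmul', Submodule.Quotient.mk_smul,
          RingHom.id_apply] }
    (BT.ext fun v w => by simp) (fun x y => BT.ext fun v w => by simp)

/-- The right action of `R` on `V ⊗_R W`. -/
def BT.ract (V W : RBimod k R) : Rᵐᵒᵖ →ₐ[k] Module.End k (BT V W) :=
  AlgHom.ofLinearMap
    { toFun x := (balRel V W).mapQ (balRel V W) (LinearMap.lTensor V.carrier (W.ract x))
        (balRel_map_r V W x)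
      map_add' x y := BT.ext fun v w => by simp
      map_smul' c x := BT.ext fun v w => by simp }
    (BT.ext fun v w => by simp) (fun x y => BT.ext fun v w => by simp)

namespace RBimod

/-- The tensor product `V ⊗_R W` of bimodules, with `x.(v ⊗ w).y = x.v ⊗ w.y`. -/
def tensor (V W : RBimod k R) : RBimod k R :=
  ofActions (BT V W) (BT.lact V W) (BT.ract V W) fun x y => BT.ext fun v w => by
    simp [BT.lact, BT.ract]

variable {V W V' W' V'' W'' : RBimod k R}

/-- The projection of `V ⊗_k W` onto `V ⊗_R W`. -/
def proj (V W : RBimod k R) : V.carrier ⊗[k] W.carrier →ₗ[k] (tensor V W).carrier :=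
  (balRel V W).mkQ

theorem proj_surjective (V W : RBimod k R) : Function.Surjective (proj V W) :=
  Submodule.mkQ_surjective _

/-- The class of `v ⊗ w` in `V ⊗_R W`. -/
def tm (v : V.carrier) (w : W.carrier) : (tensor V W).carrier := proj V W (v ⊗ₜ w)

theorem proj_tmul (v : V.carrier) (w : W.carrier) : proj V W (v ⊗ₜ w) = tm v w := rfl

theorem tm_add (v : V.carrier) (w w' : W.carrier) : tm v (w + w') = tm v w + tm v w' := by
  simp [tm, TensorProduct.tmul_add]

theorem add_tm (v v' : V.carrier) (w : W.carrier) : tm (v + v') w = tm v w + tm v' w := by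
  simp [tm, TensorProduct.add_tmul]

theorem tm_smul (c : k) (v : V.carrier) (w : W.carrier) : tm v (c • w) = c • tm v w := by
  rw [tm, TensorProduct.tmul_smul, map_smul, tm]

theorem smul_tm (c : k) (v : V.carrier) (w : W.carrier) : tm (c • v) w = c • tm v w := by
  rw [tm, ← TensorProduct.smul_tmul', map_smul, tm]

theorem tm_bal (r : R) (v : V.carrier) (w : W.carrier) :
    tm (V.ract (op r) v) w = tm v (W.lact r w) :=
  (Submodule.Quotient.eq _).2 (Submodule.subset_span ⟨r, v, w, rfl⟩)

/-- `tm` as a bilinear map. -/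
@[simps!]
def tmₗ (V W : RBimod k R) : V.carrier →ₗ[k] W.carrier →ₗ[k] (tensor V W).carrier :=
  LinearMap.mk₂ k tm add_tm smul_tm tm_add tm_smul

theorem tensor_ext {Z : Type u} [AddCommGroup Z] [Module k Z] {f g : (tensor V W).carrier →ₗ[k] Z}
    (h : ∀ v w, f (tm v w) = g (tm v w)) : f = g :=
  BT.ext h

@[simp] theorem lact_tm (x : R) (v : V.carrier) (w : W.carrier) :
    (tensor V W).lact x (tm v w) = tm (V.lact x v) w :=
  (lact_ofActions (BT V W) (BT.lact V W) (BT.ract V W) _ x _).trans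
    (Submodule.mapQ_apply (h := balRel_map_l V W x) _ _ _ _)

@[simp] theorem ract_tm (x : Rᵐᵒᵖ) (v : V.carrier) (w : W.carrier) :
    (tensor V W).ract x (tm v w) = tm v (W.ract x w) :=
  (ract_ofActions (BT V W) (BT.lact V W) (BT.ract V W) _ x _).trans
    (Submodule.mapQ_apply (h := balRel_map_r V W x) _ _ _ _)

/-- The universal property of `V ⊗_R W` among vector spaces. -/
def lift {Z : Type u} [AddCommGroup Z] [Module k Z] (f : V.carrier →ₗ[k] W.carrier →ₗ[k] Z)
    (hf : ∀ r v w, f (V.ract (op r) v) w = f v (W.lact r w)) : (tensor V W).carrier →ₗ[k] Z :=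
  (balRel V W).liftQ (TensorProduct.lift f) (Submodule.span_le.2 (by
    rintro _ ⟨r, v, w, rfl⟩
    simp [hf]))

@[simp] theorem lift_tm {Z : Type u} [AddCommGroup Z] [Module k Z]
    (f : V.carrier →ₗ[k] W.carrier →ₗ[k] Z) (hf) (v : V.carrier) (w : W.carrier) :
    lift f hf (tm v w) = f v w := by
  refine (Submodule.liftQ_apply _ _ _).trans ?_
  simp

/-- A linear map out of `V ⊗_R W` commuting with the actions on the classes `v ⊗ w`. -/
def homOfTensor {X : RBimod k R} (f : (tensor V W).carrier →ₗ[k] X.carrier)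
    (hl : ∀ x v w, f (tm (V.lact x v) w) = X.lact x (f (tm v w)))
    (hr : ∀ x v w, f (tm v (W.ract x w)) = X.ract x (f (tm v w))) : tensor V W ⟶ X :=
  homMk f
    (fun x => LinearMap.congr_fun (f := f ∘ₗ (tensor V W).lact x) (g := X.lact x ∘ₗ f)
      (tensor_ext fun v w => by simp [hl]))
    (fun x => LinearMap.congr_fun (f := f ∘ₗ (tensor V W).ract x) (g := X.ract x ∘ₗ f)
      (tensor_ext fun v w => by simp [hr]))

@[simp] theorem homOfTensor_lin {X : RBimod k R} (f : (tensor V W).carrier →ₗ[k] X.carrier)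
    (hl hr) : (homOfTensor (X := X) f hl hr).lin = f := rfl

/-- The tensor product of bimodule maps. -/
def tensorMap (f : V ⟶ V') (g : W ⟶ W') : tensor V W ⟶ tensor V' W' :=
  homOfTensor (lift ((tmₗ V' W').compl₁₂ f.lin g.lin) (fun r v w => by simp [tm_bal]))
    (fun x v w => by simp) (fun x v w => by simp)

@[simp] theorem tensorMap_tm (f : V ⟶ V') (g : W ⟶ W') (v : V.carrier) (w : W.carrier) :
    (tensorMap f g).lin (tm v w) = tm (f.lin v) (g.lin w) := by
  simp [tensorMap]

/-- The right multiplication action of `R` on itself. -/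
def rmul (k R : Type u) [Field k] [Ring R] [Algebra k R] : Rᵐᵒᵖ →ₐ[k] Module.End k R :=
  AlgHom.ofLinearMap ((LinearMap.mul k R).flip ∘ₗ (opLinearEquiv k).symm.toLinearMap)
    (by ext; simp) (fun x y => by ext; simp [mul_assoc])

@[simp] theorem rmul_apply (x : Rᵐᵒᵖ) (r : R) : rmul k R x r = r * unop x := by
  simp [rmul]

/-- The regular bimodule `R`. -/
def unit (k R : Type u) [Field k] [Ring R] [Algebra k R] : RBimod k R :=
  ofActions R (Algebra.lmul k R) (rmul k R) fun x y => by
    ext r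
    simp [mul_assoc]

/-- Elements of `R` as elements of the regular bimodule. -/
def unitEquiv (k R : Type u) [Field k] [Ring R] [Algebra k R] : R ≃ₗ[k] (unit k R).carrier :=
  LinearEquiv.refl k R

@[simp] theorem lact_unit (x r : R) :
    (unit k R).lact x (unitEquiv k R r) = unitEquiv k R (x * r) :=
  lact_ofActions R (Algebra.lmul k R) (rmul k R) _ x r

@[simp] theorem ract_unit (x : Rᵐᵒᵖ) (r : R) :
    (unit k R).ract x (unitEquiv k R r) = unitEquiv k R (r * unop x) :=
  (ract_ofActions R (Algebra.lmul k R) (rmul k R) _ x r).trans (rmul_apply x r)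

theorem tensor_induction {p : (tensor V W).carrier → Prop} (x : (tensor V W).carrier)
    (h : ∀ v w, p (tm v w)) (hadd : ∀ x y, p x → p y → p (x + y)) : p x := by
  obtain ⟨x, rfl⟩ := proj_surjective V W x
  induction x using TensorProduct.induction_on with
  | zero => simpa [tm] using h 0 0
  | tmul v w => exact h v w
  | add x y hx hy => rw [map_add]; exact hadd _ _ hx hy

/-- The universal property of a triple tensor product. -/
def lift₃ {U V W : RBimod k R} {Z : Type u} [AddCommGroup Z] [Module k Z]
    (f : U.carrier →ₗ[k] V.carrier →ₗ[k] W.carrier →ₗ[k] Z)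
    (h₁ : ∀ r u v w, f (U.ract (op r) u) v w = f u (V.lact r v) w)
    (h₂ : ∀ r u v w, f u (V.ract (op r) v) w = f u v (W.lact r w)) :
    (tensor (tensor U V) W).carrier →ₗ[k] Z :=
  lift (lift f fun r u v => LinearMap.ext fun w => h₁ r u v w) (fun r x w => by
    induction x using tensor_induction with
    | h u v => simp [h₂]
    | hadd x y hx hy => rw [map_add, map_add, map_add, LinearMap.add_apply, LinearMap.add_apply,
        hx, hy])

@[simp] theorem lift₃_tm {U V W : RBimod k R} {Z : Type u} [AddCommGroup Z] [Module k Z]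
    (f : U.carrier →ₗ[k] V.carrier →ₗ[k] W.carrier →ₗ[k] Z) (h₁ h₂)
    (u : U.carrier) (v : V.carrier) (w : W.carrier) :
    lift₃ f h₁ h₂ (tm (tm u v) w) = f u v w := by
  simp [lift₃]

theorem tensor_ext₃ {U V W : RBimod k R} {Z : Type u} [AddCommGroup Z] [Module k Z]
    {f g : (tensor (tensor U V) W).carrier →ₗ[k] Z}
    (h : ∀ u v w, f (tm (tm u v) w) = g (tm (tm u v) w)) : f = g :=
  tensor_ext fun x w => by
    induction x using tensor_induction with
    | h u v => exact h u v w
    | hadd x y hx hy => rw [add_tm, map_add, map_add, hx, hy]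

theorem tensor_ext₃' {U V W : RBimod k R} {Z : Type u} [AddCommGroup Z] [Module k Z]
    {f g : (tensor U (tensor V W)).carrier →ₗ[k] Z}
    (h : ∀ u v w, f (tm u (tm v w)) = g (tm u (tm v w))) : f = g :=
  tensor_ext fun u x => by
    induction x using tensor_induction with
    | h v w => exact h u v w
    | hadd x y hx hy => rw [tm_add, map_add, map_add, hx, hy]

/-- The associator `(u ⊗ v) ⊗ w ↦ u ⊗ (v ⊗ w)`, as a linear map. -/
def assocLin (U V W : RBimod k R) :
    (tensor (tensor U V) W).carrier →ₗ[k] (tensor U (tensor V W)).carrier :=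
  lift₃ (LinearMap.mk₂ k (fun u v => (tmₗ U (tensor V W) u) ∘ₗ tmₗ V W v)
      (fun _ _ _ => by ext; simp) (fun _ _ _ => by ext; simp)
      (fun _ _ _ => by ext; simp [tm_add]) (fun _ _ _ => by ext; simp [tm_smul]))
    (fun r u v w => by simp [tm_bal]) (fun r u v w => by simp [tm_bal])

@[simp] theorem assocLin_tm {U V W : RBimod k R} (u : U.carrier) (v : V.carrier)
    (w : W.carrier) : assocLin U V W (tm (tm u v) w) = tm u (tm v w) := by
  simp [assocLin]

/-- The inverse of the associator, as a linear map. -/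
def assocInvLin (U V W : RBimod k R) :
    (tensor U (tensor V W)).carrier →ₗ[k] (tensor (tensor U V) W).carrier :=
  lift (LinearMap.flip (lift
      (LinearMap.mk₂ k (fun v w => (tmₗ (tensor U V) W).flip w ∘ₗ (tmₗ U V).flip v)
        (fun _ _ _ => by ext; simp [add_tm, tm_add])
        (fun _ _ _ => by ext; simp [smul_tm, tm_smul])
        (fun _ _ _ => by ext; simp) (fun _ _ _ => by ext; simp))
      (fun r v w => LinearMap.ext fun u => by simp [← tm_bal])))
    (fun r u x => by
      induction x using tensor_induction with
      | h v w => simp [tm_bal]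
      | hadd x y hx hy => simp only [map_add, hx, hy])

@[simp] theorem assocInvLin_tm {U V W : RBimod k R} (u : U.carrier) (v : V.carrier)
    (w : W.carrier) : assocInvLin U V W (tm u (tm v w)) = tm (tm u v) w := by
  simp [assocInvLin]

/-- The associator `(u ⊗ v) ⊗ w ↦ u ⊗ (v ⊗ w)`. -/
def assoc (U V W : RBimod k R) : tensor (tensor U V) W ≅ tensor U (tensor V W) :=
  AlgMod.isoMk
    (homOfTensor (assocLin U V W)
      (fun x y w => by
        induction y using tensor_induction with
        | h u v => simp
        | hadd y z hy hz => simp only [map_add, add_tm, hy, hz])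
      (fun x y w => by
        induction y using tensor_induction with
        | h u v => simp
        | hadd y z hy hz => simp only [map_add, add_tm, hy, hz]))
    (homOfTensor (assocInvLin U V W)
      (fun x u y => by
        induction y using tensor_induction with
        | h u v => simp
        | hadd y z hy hz => simp only [map_add, tm_add, hy, hz])
      (fun x u y => by
        induction y using tensor_induction with
        | h u v => simp
        | hadd y z hy hz => simp only [map_add, tm_add, hy, hz]))
    (tensor_ext₃ fun u v w => by simp)
    (tensor_ext₃' fun u v w => by simp)

@[simp] theorem assoc_hom_tm {U V W : RBimod k R} (u : U.carrier) (v : V.carrier)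
    (w : W.carrier) : (assoc U V W).hom.lin (tm (tm u v) w) = tm u (tm v w) :=
  assocLin_tm u v w

theorem unit_induction {p : (unit k R).carrier → Prop} (x : (unit k R).carrier)
    (h : ∀ r : R, p (unitEquiv k R r)) : p x := by
  obtain ⟨r, rfl⟩ := (unitEquiv k R).surjective x
  exact h r

/-- The left unitor `r ⊗ v ↦ r.v`. -/
def leftUnitor (V : RBimod k R) : tensor (unit k R) V ≅ V :=
  AlgMod.isoMk
    (homOfTensor (lift (V.lact.toLinearMap ∘ₗ (unitEquiv k R).symm.toLinearMap)
        (fun r x v => by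
          induction x using unit_induction with
          | h x => simp))
      (fun x y v => by
        induction y using unit_induction with
        | h y => simp)
      (fun x y v => by
        induction y using unit_induction with
        | h y => simpa using LinearMap.congr_fun (RBimod.commute V y x) v))
    (homMk (tmₗ (unit k R) V (unitEquiv k R 1))
      (fun x v => by simp [← tm_bal]) (fun x v => by simp))
    (tensor_ext fun r v => by
        induction r using unit_induction with
        | h r => simp [← tm_bal])
    (LinearMap.ext fun v => by simp)

@[simp] theorem leftUnitor_hom_tm {V : RBimod k R} (r : R) (v : V.carrier) :
    (leftUnitor V).hom.lin (tm (unitEquiv k R r) v) = V.lact r v :=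
  lift_tm _ (fun r x v => by
    induction x using unit_induction with
    | h x => simp) _ _

/-- The right unitor `v ⊗ r ↦ v.r`. -/
def rightUnitor (V : RBimod k R) : tensor V (unit k R) ≅ V :=
  AlgMod.isoMk
    (homOfTensor (lift
        (LinearMap.flip (V.ract.toLinearMap ∘ₗ (opLinearEquiv k).toLinearMap ∘ₗ
          (unitEquiv k R).symm.toLinearMap))
        (fun r v x => by
          induction x using unit_induction with
          | h x => simp))
      (fun x v y => by
        induction y using unit_induction with
        | h y => simpa using (LinearMap.congr_fun (RBimod.commute V x (op y)) v).symm)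
      (fun x v y => by
        induction y using unit_induction with
        | h y => simp))
    (homMk ((tmₗ V (unit k R)).flip (unitEquiv k R 1))
      (fun x v => by simp)
      (fun x v => by
        have := tm_bal (unop x) v (unitEquiv k R 1)
        simpa using this))
    (tensor_ext fun v r => by
        induction r using unit_induction with
        | h r => simp [tm_bal])
    (LinearMap.ext fun v => by simp)

@[simp] theorem rightUnitor_hom_tm {V : RBimod k R} (r : R) (v : V.carrier) :
    (rightUnitor V).hom.lin (tm v (unitEquiv k R r)) = V.ract (op r) v :=
  lift_tm _ (fun r v x => by
    induction x using unit_induction with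
    | h x => simp) _ _

theorem tensor_hom_ext {X : RBimod k R} {f g : tensor V W ⟶ X}
    (h : ∀ v w, f.lin (tm v w) = g.lin (tm v w)) : f = g :=
  AlgMod.hom_ext (tensor_ext h)

instance : MonoidalCategory (RBimod k R) where
  tensorObj := tensor
  tensorHom := tensorMap
  whiskerLeft V _ _ f := tensorMap (𝟙 V) f
  whiskerRight f W := tensorMap f (𝟙 W)
  tensorUnit := unit k R
  associator := assoc
  leftUnitor := leftUnitor
  rightUnitor := rightUnitor
  tensorHom_def _ _ := tensor_hom_ext fun v w => by simp
  id_tensorHom_id _ _ := tensor_hom_ext fun v w => by simp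
  tensorHom_comp_tensorHom _ _ _ _ := tensor_hom_ext fun v w => by simp
  whiskerLeft_id _ _ := tensor_hom_ext fun v w => by simp
  id_whiskerRight _ _ := tensor_hom_ext fun v w => by simp
  associator_naturality _ _ _ := AlgMod.hom_ext (tensor_ext₃ fun u v w => by simp)
  leftUnitor_naturality _ := tensor_hom_ext fun r w => by
    induction r using unit_induction with
    | h r => simp
  rightUnitor_naturality _ := tensor_hom_ext fun v r => by
    induction r using unit_induction with
    | h r => simp
  pentagon _ _ _ _ := AlgMod.hom_ext (tensor_ext fun x z => by
    induction x using tensor_induction with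
    | h x w =>
      induction x using tensor_induction with
      | h u v => simp
      | hadd x y hx hy => simp only [map_add, add_tm, hx, hy]
    | hadd x y hx hy => simp only [map_add, add_tm, hx, hy])
  triangle _ _ := AlgMod.hom_ext (tensor_ext₃ fun u r w => by
    induction r using unit_induction with
    | h r => simp [tm_bal])

theorem tensorHom_tm (f : V ⟶ V') (g : W ⟶ W') (v : V.carrier) (w : W.carrier) :
    (f ⊗ₘ g).lin (tm v w) = tm (f.lin v) (g.lin w) :=
  tensorMap_tm f g v w

end RBimod

end Bimodules

open RBimod

/-- Source and target maps: algebra maps from `R` and its opposite to `B` with commuting images. -/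
structure SourceTarget (k R B : Type u) [Field k] [Ring R] [Algebra k R] [Ring B]
    [Algebra k B] where
  s : R →ₐ[k] B
  t : Rᵐᵒᵖ →ₐ[k] B
  commute : ∀ x y, Commute (s x) (t y)

section

variable {k R B : Type u} [Field k] [Ring R] [Algebra k R] [Ring B] [Algebra k B]

namespace SourceTarget

variable (H : SourceTarget k R B)

/-- The algebra map `x ⊗ op y ↦ s x * t y` from the enveloping algebra. -/
def e : R ⊗[k] Rᵐᵒᵖ →ₐ[k] B := Algebra.TensorProduct.lift H.s H.t H.commute

/-- Restriction of `B`-modules to `R`-bimodules. -/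
abbrev res : AlgMod k B ⥤ RBimod k R := AlgMod.restrict H.e

/-- `B` as an `R`-bimodule by left multiplication: `x.b.y = s x * t y * b`. -/
def eB : RBimod k R := H.res.obj (AlgMod.regular k B)

/-- Elements of `B` as elements of the bimodule. -/
def eBEquiv : B ≃ₗ[k] H.eB.carrier := LinearEquiv.refl k B

theorem act_eB (x : R ⊗[k] Rᵐᵒᵖ) (b : B) : H.eB.act x (H.eBEquiv b) = H.eBEquiv (H.e x * b) :=
  rfl

/-- The class in `B ⊗_R B` of an element of `B ⊗_k B`. -/
def cls : B ⊗[k] B →ₗ[k] (H.eB ⊗ H.eB : RBimod k R).carrier :=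
  proj H.eB H.eB ∘ₗ TensorProduct.map H.eBEquiv.toLinearMap H.eBEquiv.toLinearMap

theorem cls_tmul (a b : B) : H.cls (a ⊗ₜ b) = tm (H.eBEquiv a) (H.eBEquiv b) := rfl

theorem cls_surjective : Function.Surjective H.cls :=
  (proj_surjective H.eB H.eB).comp
    (TensorProduct.map_surjective H.eBEquiv.surjective H.eBEquiv.surjective)

/-- The action of `B` on the underlying bimodule of a `B`-module. -/
def bact (M : AlgMod k B) : B →ₐ[k] Module.End k (H.res.obj M).carrier := M.act

theorem act_res (M : AlgMod k B) (x : R ⊗[k] Rᵐᵒᵖ) (m : (H.res.obj M).carrier) :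
    (H.res.obj M).act x m = H.bact M (H.e x) m := rfl

theorem ract_res (M : AlgMod k B) (r : Rᵐᵒᵖ) (m : (H.res.obj M).carrier) :
    ract (H.res.obj M) r m = H.bact M (H.t r) m := by
  change H.bact M (H.e (1 ⊗ₜ r)) m = _
  simp [e]

theorem lact_res (M : AlgMod k B) (r : R) (m : (H.res.obj M).carrier) :
    lact (H.res.obj M) r m = H.bact M (H.s r) m := by
  change H.bact M (H.e (r ⊗ₜ 1)) m = _
  simp [e]

/-- A map of underlying bimodules commuting with the action of `B` is a map of `B`-modules. -/
def homMk {M N : AlgMod k B} (f : H.res.obj M ⟶ H.res.obj N)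
    (h : ∀ b m, f.lin (H.bact M b m) = H.bact N b (f.lin m)) : M ⟶ N :=
  ⟨f.lin, h⟩

/-- An isomorphism of underlying bimodules commuting with the action of `B` is an isomorphism of
`B`-modules. -/
def isoMk {M N : AlgMod k B} (f : H.res.obj M ≅ H.res.obj N)
    (h : ∀ b m, f.hom.lin (H.bact M b m) = H.bact N b (f.hom.lin m)) : M ≅ N where
  hom := H.homMk f.hom h
  inv := H.homMk f.inv fun b m => by
    have hh : ∀ x, f.inv.lin (f.hom.lin x) = x := fun x =>
      LinearMap.congr_fun (congrArg AlgMod.Hom.lin f.hom_inv_id) x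
    have hi : ∀ x, f.hom.lin (f.inv.lin x) = x := fun x =>
      LinearMap.congr_fun (congrArg AlgMod.Hom.lin f.inv_hom_id) x
    rw [← hh (H.bact M b _), h, hi]
  hom_inv_id := H.res.map_injective f.hom_inv_id
  inv_hom_id := H.res.map_injective f.inv_hom_id

theorem map_bact {M N : AlgMod k B} (f : M ⟶ N) (b : B) (m : (H.res.obj M).carrier) :
    (H.res.map f).lin (H.bact M b m) = H.bact N b ((H.res.map f).lin m) := f.comm b m

/-- The map of bimodules `a ↦ a m`. -/
def orb (M : AlgMod k B) (m : (H.res.obj M).carrier) : H.eB ⟶ H.res.obj M where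
  lin := (H.bact M).toLinearMap.flip m ∘ₗ H.eBEquiv.symm.toLinearMap
  comm a v := by
    obtain ⟨b, rfl⟩ := H.eBEquiv.surjective v
    rw [act_eB, act_res]
    simp

@[simp] theorem orb_lin (M : AlgMod k B) (m : (H.res.obj M).carrier) (a : B) :
    (H.orb M m).lin (H.eBEquiv a) = H.bact M a m := rfl

/-- Right multiplication by `c`, as a map of bimodules. -/
def rightMul (c : B) : H.eB ⟶ H.eB := H.orb (AlgMod.regular k B) c

theorem rightMul_lin (a c : B) : (H.rightMul c).lin (H.eBEquiv a) = H.eBEquiv (a * c) := rfl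

theorem orb_comp {M N : AlgMod k B} (f : M ⟶ N) (m : (H.res.obj M).carrier) :
    H.orb M m ≫ H.res.map f = H.orb N ((H.res.map f).lin m) := by
  apply AlgMod.hom_ext
  ext x
  obtain ⟨b, rfl⟩ := H.eBEquiv.surjective x
  exact H.map_bact f b m

end SourceTarget

/-- An enveloping-algebra ring `B` with a coalgebra structure on its left bimodule, in the monoidal
category of `R`-bimodules. -/
structure Coring (k R B : Type u) [Field k] [Ring R] [Algebra k R] [Ring B]
    [Algebra k B] extends SourceTarget k R B where
  coalgebra : ComonObj toSourceTarget.eB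

/-- The comultiplication `B → B ⊗_R B`. -/
def Coring.comul (H : Coring k R B) : B →ₗ[k] (H.eB ⊗ H.eB : RBimod k R).carrier :=
  H.coalgebra.comul.lin ∘ₗ H.eBEquiv.toLinearMap

/-- The counit `B → R`. -/
def Coring.counit (H : Coring k R B) : B →ₗ[k] R :=
  (unitEquiv k R).symm.toLinearMap ∘ₗ
    AlgMod.Hom.lin (W := unit k R) H.coalgebra.counit ∘ₗ H.eBEquiv.toLinearMap

/-- A (left) `×_R`-bialgebra. The axiom `takeuchi` says that `comul` takes values in the Takeuchi
product, on which multiplication is defined factorwise on representatives. -/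
structure Bialgebroid (k R B : Type u) [Field k] [Ring R] [Algebra k R] [Ring B]
    [Algebra k B] extends Coring k R B where
  takeuchi : ∀ (b : B) (r : R) (x : B ⊗[k] B), toSourceTarget.cls x = toCoring.comul b →
    toSourceTarget.cls (x * (t (op r) ⊗ₜ 1)) = toSourceTarget.cls (x * (1 ⊗ₜ s r))
  comul_mul : ∀ (b b' : B) (x x' : B ⊗[k] B), toSourceTarget.cls x = toCoring.comul b →
    toSourceTarget.cls x' = toCoring.comul b' →
    toCoring.comul (b * b') = toSourceTarget.cls (x * x')
  comul_one : toCoring.comul 1 = toSourceTarget.cls (1 ⊗ₜ 1)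
  counit_mul_s : ∀ b b' : B,
    toCoring.counit (b * s (toCoring.counit b')) = toCoring.counit (b * b')
  counit_mul_t : ∀ b b' : B,
    toCoring.counit (b * t (op (toCoring.counit b'))) = toCoring.counit (b * b')
  counit_one : toCoring.counit 1 = 1

namespace Bialgebroid

variable (H : Bialgebroid k R B)

theorem comul_eBEquiv (b : B) : H.coalgebra.comul.lin (H.eBEquiv b) = H.comul b := rfl

theorem counit_eBEquiv (b : B) :
    AlgMod.Hom.lin (W := unit k R) H.coalgebra.counit (H.eBEquiv b) =
      unitEquiv k R (H.counit b) := rfl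

theorem orb_tensor_cls (M N : AlgMod k B) (m : (H.res.obj M).carrier) (n : (H.res.obj N).carrier) (a c : B) :
    (H.orb M m ⊗ₘ H.orb N n).lin (H.cls (a ⊗ₜ c)) =
      tm (H.bact M a m) (H.bact N c n) :=
  tensorHom_tm (H.orb M m) (H.orb N n) (H.eBEquiv a) (H.eBEquiv c)

theorem cls_induction {p : B ⊗[k] B → Prop} (x : B ⊗[k] B) (h : ∀ a c, p (a ⊗ₜ c))
    (hadd : ∀ x y, p x → p y → p (x + y)) : p x := by
  induction x using TensorProduct.induction_on with
  | zero => simpa using h 0 0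
  | tmul v w => exact h v w
  | add x y hx hy => exact hadd _ _ hx hy

/-- The bilinear map `(m, n) ↦ z (m ⊗ n)` for `z` in `B ⊗_R B`. -/
def pairAct (M N : AlgMod k B) (z : (H.eB ⊗ H.eB : RBimod k R).carrier) :
    (H.res.obj M).carrier →ₗ[k] (H.res.obj N).carrier →ₗ[k] (tensor (H.res.obj M) (H.res.obj N)).carrier :=
  LinearMap.mk₂ k (fun m n => (H.orb M m ⊗ₘ H.orb N n).lin z)
    (fun m m' n => by
      obtain ⟨x, rfl⟩ := H.cls_surjective z
      induction x using cls_induction with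
      | h a c => simp only [orb_tensor_cls, map_add]; exact add_tm _ _ _
      | hadd x y hx hy => simp only [map_add, hx, hy]; abel)
    (fun r m n => by
      obtain ⟨x, rfl⟩ := H.cls_surjective z
      induction x using cls_induction with
      | h a c => simp only [orb_tensor_cls, map_smul]; exact smul_tm _ _ _
      | hadd x y hx hy => simp only [map_add, hx, hy, smul_add])
    (fun m n n' => by
      obtain ⟨x, rfl⟩ := H.cls_surjective z
      induction x using cls_induction with
      | h a c => simp only [orb_tensor_cls, map_add]; exact tm_add _ _ _
      | hadd x y hx hy => simp only [map_add, hx, hy]; abel)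
    (fun r m n => by
      obtain ⟨x, rfl⟩ := H.cls_surjective z
      induction x using cls_induction with
      | h a c => simp only [orb_tensor_cls, map_smul]; exact tm_smul _ _ _
      | hadd x y hx hy => simp only [map_add, hx, hy, smul_add])

theorem pairAct_apply (M N : AlgMod k B) (z : (H.eB ⊗ H.eB : RBimod k R).carrier)
    (m : (H.res.obj M).carrier) (n : (H.res.obj N).carrier) :
    H.pairAct M N z m n = (H.orb M m ⊗ₘ H.orb N n).lin z := rfl

theorem pairAct_mul_t (M N : AlgMod k B) (x : B ⊗[k] B) (a c : B)
    (m : (H.res.obj M).carrier) (n : (H.res.obj N).carrier) :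
    H.pairAct M N (H.cls (x * (a ⊗ₜ c))) m n =
      H.pairAct M N (H.cls x) (H.bact M a m) (H.bact N c n) := by
  induction x using cls_induction with
  | h a c => simp [pairAct_apply, orb_tensor_cls]
  | hadd x y hx hy =>
    simp only [pairAct_apply, add_mul, map_add] at hx hy ⊢
    rw [hx, hy]

/-- The action of `b` on `M ⊗_R N` through the comultiplication:
`b (m ⊗ n) = b₁ m ⊗ b₂ n`. -/
def actLin (M N : AlgMod k B) (b : B) :
    (tensor (H.res.obj M) (H.res.obj N)).carrier →ₗ[k]
      (tensor (H.res.obj M) (H.res.obj N)).carrier :=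
  RBimod.lift (H.pairAct M N (H.comul b)) (fun r m n => by
    obtain ⟨x, hx⟩ := H.cls_surjective (H.comul b)
    have := congrArg (fun z => H.pairAct M N z m n) (H.takeuchi b r x hx)
    simp only [pairAct_mul_t, map_one, Module.End.one_apply, hx] at this
    rw [H.ract_res, H.lact_res]
    exact this)

theorem actLin_tm (M N : AlgMod k B) (b : B) (m : (H.res.obj M).carrier) (n : (H.res.obj N).carrier) :
    H.actLin M N b (tm m n) =
      (H.orb M m ⊗ₘ H.orb N n).lin (H.comul b) :=
  lift_tm _ _ _ _

theorem actLin_orb (M N : AlgMod k B) (b b' : B) (m : (H.res.obj M).carrier) (n : (H.res.obj N).carrier) :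
    H.actLin M N b ((H.orb M m ⊗ₘ H.orb N n).lin (H.comul b')) =
      (H.orb M m ⊗ₘ H.orb N n).lin (H.comul (b * b')) := by
  obtain ⟨x, hx⟩ := H.cls_surjective (H.comul b)
  obtain ⟨x', hx'⟩ := H.cls_surjective (H.comul b')
  rw [H.comul_mul b b' x x' hx hx', ← hx']
  clear hx'
  induction x' using cls_induction with
  | h a c =>
    rw [orb_tensor_cls, actLin_tm, ← hx]
    exact (H.pairAct_mul_t M N x a c m n).symm
  | hadd y z hy hz => simp only [mul_add, map_add, hy, hz]

/-- The action of `B` on `M ⊗_R N`. -/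
def actHom (M N : AlgMod k B) :
    B →ₐ[k] Module.End k (tensor (H.res.obj M) (H.res.obj N)).carrier :=
  AlgHom.ofLinearMap
    { toFun b := H.actLin M N b
      map_add' b b' := tensor_ext fun m n => by simp [actLin_tm]
      map_smul' c b := tensor_ext fun m n => by simp [actLin_tm] }
    (tensor_ext fun m n => by
      change H.actLin M N 1 _ = tm _ _
      rw [actLin_tm, comul_one, orb_tensor_cls]
      simp)
    (fun b b' => tensor_ext fun m n => by
      change H.actLin M N (b * b') _ = H.actLin M N b (H.actLin M N b' _)
      rw [actLin_tm, actLin_tm, actLin_orb])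

/-- The tensor product of two `B`-modules: `M ⊗_R N` with `b (m ⊗ n) = b₁ m ⊗ b₂ n`. -/
def tensorMod (M N : AlgMod k B) : AlgMod k B where
  carrier := (tensor (H.res.obj M) (H.res.obj N)).carrier
  act := H.actHom M N

theorem comul_e_mul (x : R ⊗[k] Rᵐᵒᵖ) (b : B) :
    H.comul (H.e x * b) = (H.eB ⊗ H.eB : RBimod k R).act x (H.comul b) :=
  H.coalgebra.comul.comm x (H.eBEquiv b)

theorem counit_e_mul (x : R ⊗[k] Rᵐᵒᵖ) (b : B) :
    unitEquiv k R (H.counit (H.e x * b)) = (unit k R).act x (unitEquiv k R (H.counit b)) :=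
  H.coalgebra.counit.comm x (H.eBEquiv b)

theorem counit_s_mul (r : R) (b : B) : H.counit (H.s r * b) = r * H.counit b := by
  have := H.counit_e_mul (r ⊗ₜ 1) b
  have h2 : H.e (r ⊗ₜ 1) = H.s r := by simp [SourceTarget.e]
  rw [h2] at this
  exact (unitEquiv k R).injective (this.trans (lact_unit _ _))

theorem counit_t_mul (r : R) (b : B) : H.counit (H.t (op r) * b) = H.counit b * r := by
  have := H.counit_e_mul (1 ⊗ₜ op r) b
  have h2 : H.e (1 ⊗ₜ op r) = H.t (op r) := by simp [SourceTarget.e]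
  rw [h2] at this
  exact (unitEquiv k R).injective (this.trans (ract_unit _ _))

theorem counit_s (r : R) : H.counit (H.s r) = r := by
  simpa [H.counit_one] using H.counit_s_mul r 1

theorem actHom_e (M N : AlgMod k B) (x : R ⊗[k] Rᵐᵒᵖ) :
    H.actHom M N (H.e x) = (tensor (H.res.obj M) (H.res.obj N)).act x :=
  tensor_ext fun m n => by
    change H.actLin M N (H.e x) _ = _
    have h := H.comul_e_mul x 1
    rw [mul_one] at h
    rw [actLin_tm, h, (H.orb M m ⊗ₘ H.orb N n).comm, comul_one, orb_tensor_cls]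
    simp only [map_one, Module.End.one_apply]
    rfl

/-- The canonical action of `B` on `R`: `b.r = counit (b * s r)`. -/
def unitHom : B →ₐ[k] Module.End k R :=
  AlgHom.ofLinearMap
    (LinearMap.mk₂ k (fun b r => H.counit (b * H.s r))
      (fun _ _ _ => by simp [add_mul]) (fun _ _ _ => by simp)
      (fun _ _ _ => by simp [mul_add]) (fun _ _ _ => by simp))
    (by
      ext r
      simp [H.counit_s])
    (fun b b' => by
      ext r
      simp [counit_mul_s, mul_assoc])

theorem unitHom_apply (b : B) (r : R) : H.unitHom b r = H.counit (b * H.s r) := rfl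

/-- The regular bimodule `R` with the canonical action of `B`. -/
def unitMod : AlgMod k B where
  carrier := R
  act := H.unitHom

theorem unitHom_e (x : R ⊗[k] Rᵐᵒᵖ) (r : R) :
    unitEquiv k R (H.unitHom (H.e x) r) = (unit k R).act x (unitEquiv k R r) := by
  rw [unitHom_apply, counit_e_mul, counit_s]

/-- The underlying bimodule of `unitMod` is the regular bimodule. -/
theorem res_unitMod : H.res.obj H.unitMod = unit k R := by
  have h : H.unitHom.comp H.e = (unit k R).act :=
    AlgHom.ext fun x => LinearMap.ext fun r => H.unitHom_e x r
  exact congrArg (fun f => AlgMod.mk (k := k) (A := R ⊗[k] Rᵐᵒᵖ) R f) h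

/-- The underlying bimodule of `tensorMod` is the tensor product of the underlying bimodules. -/
theorem res_tensorMod (M N : AlgMod k B) :
    H.res.obj (H.tensorMod M N) = tensor (H.res.obj M) (H.res.obj N) := by
  have h : (H.actHom M N).comp H.e = (tensor (H.res.obj M) (H.res.obj N)).act :=
    AlgHom.ext fun x => H.actHom_e M N x
  exact congrArg (fun f => AlgMod.mk (k := k) (A := R ⊗[k] Rᵐᵒᵖ)
    (tensor (H.res.obj M) (H.res.obj N)).carrier f) h

/-- The identity, as an isomorphism of bimodules from the tensor product of bimodules to the
underlying bimodule of the tensor product of `B`-modules. -/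
def mu (M N : AlgMod k B) :
    (H.res.obj M ⊗ H.res.obj N : RBimod k R) ≅ H.res.obj (H.tensorMod M N) :=
  AlgMod.isoMk
    ⟨LinearMap.id, fun x v => (LinearMap.congr_fun (H.actHom_e M N x) v).symm⟩
    ⟨LinearMap.id, fun x v => LinearMap.congr_fun (H.actHom_e M N x) v⟩ rfl rfl

/-- The identity, as an isomorphism of bimodules from the regular bimodule to the underlying
bimodule of `unitMod`. -/
def eta : (𝟙_ (RBimod k R)) ≅ H.res.obj H.unitMod :=
  AlgMod.isoMk
    ⟨LinearMap.id, fun x v => (H.unitHom_e x v).symm⟩ ⟨LinearMap.id, H.unitHom_e⟩ rfl rfl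

theorem lin_comp_apply {V W X : RBimod k R} (f : V ⟶ W) (g : W ⟶ X) (v : V.carrier) :
    (f ≫ g).lin v = g.lin (f.lin v) := rfl

/-- The defining formula `b (m ⊗ n) = b₁ m ⊗ b₂ n`, as an equation of bimodule maps. -/
theorem orb_tensorMod (M N : AlgMod k B) (m : (H.res.obj M).carrier)
    (n : (H.res.obj N).carrier) :
    H.orb (H.tensorMod M N) ((H.mu M N).hom.lin (tm m n)) =
      H.coalgebra.comul ≫ (H.orb M m ⊗ₘ H.orb N n) ≫ (H.mu M N).hom := by
  apply AlgMod.hom_ext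
  ext x
  obtain ⟨b, rfl⟩ := H.eBEquiv.surjective x
  exact H.actLin_tm M N b m n

theorem bact_mu (M N : AlgMod k B) (b : B) (m : (H.res.obj M).carrier)
    (n : (H.res.obj N).carrier) :
    H.bact (H.tensorMod M N) b ((H.mu M N).hom.lin (tm m n)) =
      (H.mu M N).hom.lin ((H.orb M m ⊗ₘ H.orb N n).lin (H.comul b)) :=
  H.actLin_tm M N b m n

theorem mu_induction {M N : AlgMod k B} {p : (H.res.obj (H.tensorMod M N)).carrier → Prop}
    (x : (H.res.obj (H.tensorMod M N)).carrier)
    (h : ∀ m n, p ((H.mu M N).hom.lin (tm m n))) (hadd : ∀ x y, p x → p y → p (x + y)) : p x := by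
  exact tensor_induction (V := H.res.obj M) (W := H.res.obj N) (p := p) x h hadd

theorem bact_of_orb {M N : AlgMod k B} (f : H.res.obj M ⟶ H.res.obj N)
    {v : (H.res.obj M).carrier} {w : (H.res.obj N).carrier} (hw : f.lin v = w)
    (h : H.orb M v ≫ f = H.orb N w) (b : B) :
    f.lin (H.bact M b v) = H.bact N b (f.lin v) := by
  rw [hw]
  exact LinearMap.congr_fun (congrArg AlgMod.Hom.lin h) (H.eBEquiv b)

theorem lin_inv_hom {V W : RBimod k R} (f : V ≅ W) (v : V.carrier) :
    f.inv.lin (f.hom.lin v) = v :=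
  LinearMap.congr_fun (congrArg AlgMod.Hom.lin f.hom_inv_id) v

theorem assoc_tm {U V W : RBimod k R} (u : U.carrier) (v : V.carrier) (w : W.carrier) :
    (α_ U V W).hom.lin (tm (tm u v) w) = tm u (tm v w) :=
  assoc_hom_tm u v w

/-- The tensor product of `B`-linear maps. -/
def tensorHom {M N M' N' : AlgMod k B} (f : M ⟶ M') (g : N ⟶ N') :
    H.tensorMod M N ⟶ H.tensorMod M' N' :=
  H.homMk ((H.mu M N).inv ≫ (H.res.map f ⊗ₘ H.res.map g) ≫ (H.mu M' N').hom) (fun b x => by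
    induction x using mu_induction with
    | h m n =>
      refine H.bact_of_orb _ (w := (H.mu M' N').hom.lin
        (tm ((H.res.map f).lin m) ((H.res.map g).lin n))) ?_ ?_ b
      · rw [lin_comp_apply, lin_inv_hom]
        rfl
      · rw [orb_tensorMod, orb_tensorMod, ← H.orb_comp, ← H.orb_comp]
        simp
    | hadd x y hx hy => simp only [map_add, hx, hy])

/-- The associator. -/
def associator (M N P : AlgMod k B) :
    H.tensorMod (H.tensorMod M N) P ≅ H.tensorMod M (H.tensorMod N P) :=
  H.isoMk ((H.mu _ _).symm ≪≫ ((H.mu M N).symm ⊗ᵢ Iso.refl (H.res.obj P)) ≪≫ α_ _ _ _ ≪≫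
      (Iso.refl (H.res.obj M) ⊗ᵢ H.mu N P) ≪≫ H.mu _ _) (fun b x => by
    induction x using mu_induction with
    | h x p =>
      induction x using mu_induction with
      | h m n =>
        refine H.bact_of_orb _ (w := (H.mu _ _).hom.lin
          (tm m ((H.mu N P).hom.lin (tm n p)))) ?_ ?_ b
        · rfl
        · rw [orb_tensorMod, orb_tensorMod, orb_tensorMod, orb_tensorMod]
          have h := H.coalgebra.comul_assoc
          simp only [Iso.trans_hom, Iso.symm_hom, tensorIso_hom, Iso.refl_hom, Category.assoc,
            Iso.hom_inv_id_assoc, MonoidalCategory.tensorHom_comp_tensorHom_assoc,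
            Category.comp_id, Iso.hom_inv_id]
          have h1 : (H.coalgebra.comul ≫ (H.orb M m ⊗ₘ H.orb N n)) ⊗ₘ H.orb P p =
              H.coalgebra.comul ▷ H.eB ≫ ((H.orb M m ⊗ₘ H.orb N n) ⊗ₘ H.orb P p) := by
            rw [← MonoidalCategory.tensorHom_id, MonoidalCategory.tensorHom_comp_tensorHom,
              Category.id_comp]
          have h2 : H.orb M m ⊗ₘ (H.coalgebra.comul ≫ (H.orb N n ⊗ₘ H.orb P p) ≫
              (H.mu N P).hom) = H.eB ◁ H.coalgebra.comul ≫
                (H.orb M m ⊗ₘ (H.orb N n ⊗ₘ H.orb P p)) ≫ (𝟙 _ ⊗ₘ (H.mu N P).hom) := by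
            simp [← MonoidalCategory.id_tensorHom]
          rw [h1, h2]
          simp only [Category.assoc, MonoidalCategory.associator_naturality_assoc]
          rw [reassoc_of% h]
      | hadd x y hx hy => simp only [map_add, add_tm, hx, hy]
    | hadd x y hx hy => simp only [map_add, hx, hy])

theorem comul_s (r : R) : H.comul (H.s r) = H.cls (H.s r ⊗ₜ 1) := by
  have h2 : H.e (r ⊗ₜ 1) = H.s r := by simp [SourceTarget.e]
  have := H.comul_e_mul (r ⊗ₜ 1) 1
  rw [mul_one, h2, comul_one] at this
  refine this.trans ((lact_tm r (H.eBEquiv 1) (H.eBEquiv 1)).trans ?_)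
  rw [SourceTarget.cls_tmul]
  congr 1
  change H.eBEquiv (H.e (r ⊗ₜ 1) * 1) = _
  rw [h2, mul_one]

theorem comul_t (r : R) : H.comul (H.t (op r)) = H.cls (1 ⊗ₜ H.t (op r)) := by
  have h2 : H.e (1 ⊗ₜ op r) = H.t (op r) := by simp [SourceTarget.e]
  have := H.comul_e_mul (1 ⊗ₜ op r) 1
  rw [mul_one, h2, comul_one] at this
  refine this.trans ((ract_tm (op r) (H.eBEquiv 1) (H.eBEquiv 1)).trans ?_)
  rw [SourceTarget.cls_tmul]
  congr 1
  change H.eBEquiv (H.e (1 ⊗ₜ op r) * 1) = _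
  rw [h2, mul_one]

theorem rightMul_tensor_cls (c d : B) (x : B ⊗[k] B) :
    (H.rightMul c ⊗ₘ H.rightMul d).lin (H.cls x) =
      H.cls (x * (c ⊗ₜ d)) := by
  induction x using cls_induction with
  | h a b =>
    rw [SourceTarget.cls_tmul, tensorHom_tm, SourceTarget.rightMul_lin, SourceTarget.rightMul_lin]
    simp [SourceTarget.cls_tmul]
  | hadd x y hx hy => simp only [map_add, add_mul, hx, hy]

theorem comul_mul_s (b : B) (r : R) :
    H.comul (b * H.s r) =
      (H.rightMul (H.s r) ⊗ₘ H.rightMul 1).lin (H.comul b) := by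
  obtain ⟨x, hx⟩ := H.cls_surjective (H.comul b)
  rw [H.comul_mul _ _ x _ hx (H.comul_s r).symm, ← hx, rightMul_tensor_cls]

theorem comul_mul_t (b : B) (r : R) :
    H.comul (b * H.t (op r)) =
      (H.rightMul 1 ⊗ₘ H.rightMul (H.t (op r))).lin (H.comul b) := by
  obtain ⟨x, hx⟩ := H.cls_surjective (H.comul b)
  rw [H.comul_mul _ _ x _ hx (H.comul_t r).symm, ← hx, rightMul_tensor_cls]

theorem rightMul_orb (M : AlgMod k B) (c : B) (m : (H.res.obj M).carrier) :
    H.rightMul c ≫ H.orb M m = H.orb M (H.bact M c m) := by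
  apply AlgMod.hom_ext
  ext x
  obtain ⟨b, rfl⟩ := H.eBEquiv.surjective x
  rw [lin_comp_apply, SourceTarget.rightMul_lin]
  simp

theorem orb_unitMod_s (r : R) :
    H.orb H.unitMod (H.eta.hom.lin (unitEquiv k R r)) =
      H.rightMul (H.s r) ≫ H.coalgebra.counit ≫ H.eta.hom := by
  apply AlgMod.hom_ext
  ext x
  obtain ⟨b, rfl⟩ := H.eBEquiv.surjective x
  rfl

theorem counit_mul_s_eq_t (b : B) (r : R) :
    H.counit (b * H.s r) = H.counit (b * H.t (op r)) := by
  have h1 := H.counit_mul_s b (H.s r)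
  have h2 := H.counit_mul_t b (H.s r)
  rw [counit_s] at h1 h2
  rw [h2]

theorem orb_unitMod_t (r : R) :
    H.orb H.unitMod (H.eta.hom.lin (unitEquiv k R r)) =
      H.rightMul (H.t (op r)) ≫ H.coalgebra.counit ≫ H.eta.hom := by
  apply AlgMod.hom_ext
  ext x
  obtain ⟨b, rfl⟩ := H.eBEquiv.surjective x
  exact H.counit_mul_s_eq_t b r

theorem leftUnitor_tm {V : RBimod k R} (r : R) (v : V.carrier) :
    (λ_ V).hom.lin (tm (unitEquiv k R r) v) = V.lact r v := leftUnitor_hom_tm r v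

theorem rightUnitor_tm {V : RBimod k R} (r : R) (v : V.carrier) :
    (ρ_ V).hom.lin (tm v (unitEquiv k R r)) = V.ract (op r) v := rightUnitor_hom_tm r v

theorem eta_surjective (x : (H.res.obj H.unitMod).carrier) :
    ∃ r : R, H.eta.hom.lin (unitEquiv k R r) = x := ⟨x, rfl⟩

/-- The left unitor. -/
def leftUnitor (M : AlgMod k B) : H.tensorMod H.unitMod M ≅ M :=
  H.isoMk ((H.mu _ _).symm ≪≫ (H.eta.symm ⊗ᵢ Iso.refl (H.res.obj M)) ≪≫ λ_ _) (fun b x => by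
    induction x using mu_induction with
    | h r m =>
        obtain ⟨r, rfl⟩ := H.eta_surjective r
        have h := H.coalgebra.counit_comul
        have hw : ((H.mu _ _).symm ≪≫ (H.eta.symm ⊗ᵢ Iso.refl (H.res.obj M)) ≪≫ λ_ _).hom.lin
            ((H.mu H.unitMod M).hom.lin (tm (H.eta.hom.lin (unitEquiv k R r)) m)) =
              H.bact M (H.s r) m :=
          (leftUnitor_tm r m).trans (H.lact_res M r m)
        refine H.bact_of_orb _ hw ?_ b
        rw [orb_tensorMod, orb_unitMod_s]
        have h3 : H.coalgebra.comul ≫ (H.rightMul (H.s r) ⊗ₘ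
            H.rightMul 1) = H.rightMul (H.s r) ≫
              H.coalgebra.comul := by
          apply AlgMod.hom_ext
          ext x
          obtain ⟨b, rfl⟩ := H.eBEquiv.surjective x
          exact (H.comul_mul_s b r).symm
        have h4 : H.rightMul 1 = 𝟙 _ := by
          apply AlgMod.hom_ext
          ext x
          obtain ⟨b, rfl⟩ := H.eBEquiv.surjective x
          rw [SourceTarget.rightMul_lin, mul_one]
          rfl
        rw [h4] at h3
        have h5 : (H.rightMul (H.s r) ≫ H.coalgebra.counit ≫ H.eta.hom) ⊗ₘ
            H.orb M m = (H.rightMul (H.s r) ⊗ₘ 𝟙 _) ≫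
              H.coalgebra.counit ▷ H.eB ≫ (H.eta.hom ⊗ₘ H.orb M m) := by
          simp [← MonoidalCategory.tensorHom_id]
        rw [h5]
        simp only [Category.assoc]
        rw [reassoc_of% h3, reassoc_of% h, ← rightMul_orb]
        simp [MonoidalCategory.tensorHom_def']
    | hadd x y hx hy => simp only [map_add, hx, hy])

/-- The right unitor. -/
def rightUnitor (M : AlgMod k B) : H.tensorMod M H.unitMod ≅ M :=
  H.isoMk ((H.mu _ _).symm ≪≫ (Iso.refl (H.res.obj M) ⊗ᵢ H.eta.symm) ≪≫ ρ_ _) (fun b x => by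
    induction x using mu_induction with
    | h m r =>
        obtain ⟨r, rfl⟩ := H.eta_surjective r
        have h := H.coalgebra.comul_counit
        have hw : ((H.mu _ _).symm ≪≫ (Iso.refl (H.res.obj M) ⊗ᵢ H.eta.symm) ≪≫ ρ_ _).hom.lin
            ((H.mu M H.unitMod).hom.lin (tm m (H.eta.hom.lin (unitEquiv k R r)))) =
              H.bact M (H.t (op r)) m :=
          (rightUnitor_tm r m).trans (H.ract_res M (op r) m)
        refine H.bact_of_orb _ hw ?_ b
        rw [orb_tensorMod, orb_unitMod_t]
        have h3 : H.coalgebra.comul ≫ (H.rightMul 1 ⊗ₘ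
            H.rightMul (H.t (op r))) = H.rightMul (H.t (op r)) ≫
              H.coalgebra.comul := by
          apply AlgMod.hom_ext
          ext x
          obtain ⟨b, rfl⟩ := H.eBEquiv.surjective x
          exact (H.comul_mul_t b r).symm
        have h4 : H.rightMul 1 = 𝟙 _ := by
          apply AlgMod.hom_ext
          ext x
          obtain ⟨b, rfl⟩ := H.eBEquiv.surjective x
          rw [SourceTarget.rightMul_lin, mul_one]
          rfl
        rw [h4] at h3
        have h5 : H.orb M m ⊗ₘ (H.rightMul (H.t (op r)) ≫ H.coalgebra.counit ≫
            H.eta.hom) = (𝟙 _ ⊗ₘ H.rightMul (H.t (op r))) ≫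
              H.eB ◁ H.coalgebra.counit ≫ (H.orb M m ⊗ₘ H.eta.hom) := by
          simp [← MonoidalCategory.id_tensorHom]
        rw [h5]
        simp only [Category.assoc]
        rw [reassoc_of% h3, reassoc_of% h, ← rightMul_orb]
        simp [MonoidalCategory.tensorHom_def]
    | hadd x y hx hy => simp only [map_add, hx, hy])

/-- The category of left modules over (the total algebra of) a `×_R`-bialgebra. -/
def Mod (_ : Bialgebroid k R B) : Type (u + 1) := AlgMod k B

instance : Category H.Mod := inferInstanceAs (Category (AlgMod k B))

/-- The forgetful functor from `B`-modules to `R`-bimodules. -/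
def forget : H.Mod ⥤ RBimod k R := AlgMod.restrict H.e

instance : H.forget.Faithful := inferInstanceAs (AlgMod.restrict H.e).Faithful

instance : MonoidalCategoryStruct H.Mod where
  tensorObj M N := H.tensorMod M N
  tensorHom f g := H.tensorHom f g
  whiskerLeft M _ _ f := H.tensorHom (𝟙 M) f
  whiskerRight f M := H.tensorHom f (𝟙 M)
  tensorUnit := H.unitMod
  associator M N P := H.associator M N P
  leftUnitor M := H.leftUnitor M
  rightUnitor M := H.rightUnitor M

/-- The comparison data for the forgetful functor. -/
def inducing : Monoidal.InducingFunctorData H.forget where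
  μIso M N := H.mu M N
  εIso := H.eta
  whiskerLeft_eq _ _ _ _ := rfl
  whiskerRight_eq _ _ := rfl
  tensorHom_eq _ _ := rfl
  associator_eq M N P := by
    simp only [Iso.trans_assoc]
    rfl
  leftUnitor_eq M := by
    simp only [Iso.trans_assoc]
    rfl
  rightUnitor_eq M := by
    simp only [Iso.trans_assoc]
    rfl

instance : MonoidalCategory H.Mod := Monoidal.induced H.forget H.inducing

instance : H.forget.Monoidal := Monoidal.fromInducedMonoidal H.forget H.inducing

end Bialgebroid

end

section Categorical

variable {C D : Type*} [Category C] [Category D] [MonoidalCategory C] [MonoidalCategory D]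

/-- `K` is a dualizing object: the functors `Hom(- ⊗ Y, K)` are represented by objects `D Y`, and
the induced contravariant functor `D` is an antiequivalence. -/
def IsDualizing (K : C) : Prop :=
  ∃ (D : Cᵒᵖ ⥤ C) (φ : ∀ X Y : C, (X ⊗ Y ⟶ K) ≃ (X ⟶ D.obj (Opposite.op Y))),
    (∀ (X X' Y : C) (f : X' ⟶ X) (g : X ⊗ Y ⟶ K), φ X' Y (f ▷ Y ≫ g) = f ≫ φ X Y g) ∧
    (∀ (X Y Y' : C) (h : Y' ⟶ Y) (g : X ⊗ Y ⟶ K),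
      φ X Y' (X ◁ h ≫ g) = φ X Y g ≫ D.map h.op) ∧
    D.IsEquivalence

/-- The left internal hom comparator `F (X ⊸ Y) ⟶ F X ⊸ F Y`, where `X ⊸ -` is right adjoint to
`X ⊗ -`: the transpose of the image under `F` of the evaluation. -/
def leftComparator (F : C ⥤ D) [F.LaxMonoidal] {X : C} {G : C ⥤ C} {G' : D ⥤ D}
    (adj : tensorLeft X ⊣ G) (adj' : tensorLeft (F.obj X) ⊣ G') (Y : C) :
    F.obj (G.obj Y) ⟶ G'.obj (F.obj Y) :=
  adj'.unit.app (F.obj (G.obj Y)) ≫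
    G'.map (Functor.LaxMonoidal.μ F X (G.obj Y) ≫ F.map (adj.counit.app Y))

/-- The right internal hom comparator, for right adjoints of `- ⊗ X`. -/
def rightComparator (F : C ⥤ D) [F.LaxMonoidal] {X : C} {G : C ⥤ C} {G' : D ⥤ D}
    (adj : tensorRight X ⊣ G) (adj' : tensorRight (F.obj X) ⊣ G') (Y : C) :
    F.obj (G.obj Y) ⟶ G'.obj (F.obj Y) :=
  adj'.unit.app (F.obj (G.obj Y)) ≫
    G'.map (Functor.LaxMonoidal.μ F (G.obj Y) X ≫ F.map (adj.counit.app Y))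

/-- A monoidal category is closed if all `X ⊗ -` and all `- ⊗ X` have right adjoints. -/
def IsClosedMonoidal (C : Type*) [Category C] [MonoidalCategory C] : Prop :=
  ∀ X : C, (tensorLeft X).IsLeftAdjoint ∧ (tensorRight X).IsLeftAdjoint

/-- A lax monoidal functor is closed if source and target are closed monoidal categories and both
internal hom comparators are invertible. -/
def IsClosedFunctor (F : C ⥤ D) [F.LaxMonoidal] : Prop :=
  IsClosedMonoidal C ∧ IsClosedMonoidal D ∧
    (∀ (X Y : C) (G : C ⥤ C) (G' : D ⥤ D) (adj : tensorLeft X ⊣ G)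
      (adj' : tensorLeft (F.obj X) ⊣ G'), IsIso (leftComparator F adj adj' Y)) ∧
    (∀ (X Y : C) (G : C ⥤ C) (G' : D ⥤ D) (adj : tensorRight X ⊣ G)
      (adj' : tensorRight (F.obj X) ⊣ G'), IsIso (rightComparator F adj adj' Y))

/-- A lax monoidal functor is strict monoidal if it preserves unit object and tensor products on
the nose and its structure morphisms are identities. -/
structure IsStrictMonoidal (F : C ⥤ D) [F.LaxMonoidal] : Prop where
  unit_eq : 𝟙_ D = F.obj (𝟙_ C)
  tensor_eq : ∀ X Y : C, F.obj X ⊗ F.obj Y = F.obj (X ⊗ Y)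
  ε_eq : Functor.LaxMonoidal.ε F = eqToHom unit_eq
  μ_eq : ∀ X Y : C, Functor.LaxMonoidal.μ F X Y = eqToHom (tensor_eq X Y)

end Categorical

section

variable {k R B : Type u} [Field k] [Ring R] [Algebra k R] [Ring B] [Algebra k B]

theorem finiteDimensional_tensor (V W : RBimod k R) [FiniteDimensional k V.carrier]
    [FiniteDimensional k W.carrier] : FiniteDimensional k (tensor V W).carrier :=
  Module.Finite.of_surjective _ (proj_surjective V W)

/-- The property of being finite-dimensional, for bimodules. -/
def finDimBimod (k R : Type u) [Field k] [Ring R] [Algebra k R] : ObjectProperty (RBimod k R) :=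
  fun V => FiniteDimensional k V.carrier

instance [FiniteDimensional k R] : (finDimBimod k R).IsMonoidal where
  prop_unit := inferInstanceAs (FiniteDimensional k R)
  prop_tensor V W (_ : FiniteDimensional k V.carrier) (_ : FiniteDimensional k W.carrier) :=
    finiteDimensional_tensor V W

/-- The monoidal category of finite-dimensional `R`-bimodules. -/
abbrev FdBimod (k R : Type u) [Field k] [Ring R] [Algebra k R] : Type (u + 1) :=
  (finDimBimod k R).FullSubcategory

/-- The `k`-linear dual of `R`, with the bimodule structure `(z.f.x) y = f (x * y * z)`. -/
def dualBimod (k R : Type u) [Field k] [Ring R] [Algebra k R] : RBimod k R :=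
  ofActions (Module.Dual k R)
    (AlgHom.ofLinearMap (Module.Dual.transpose ∘ₗ (LinearMap.mul k R).flip)
      (by ext; simp [Module.Dual.transpose_apply]) (fun x y => by ext; simp [mul_assoc, Module.Dual.transpose_apply]))
    (AlgHom.ofLinearMap (Module.Dual.transpose ∘ₗ LinearMap.mul k R ∘ₗ
        (opLinearEquiv k).symm.toLinearMap)
      (by ext; simp [Module.Dual.transpose_apply]) (fun x y => by ext; simp [mul_assoc, Module.Dual.transpose_apply]))
    (fun x y => by ext; simp [mul_assoc, Module.Dual.transpose_apply])

/-- The dual bimodule of `R`, as a finite-dimensional bimodule. -/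
def dualFdBimod (k R : Type u) [Field k] [Ring R] [Algebra k R] [FiniteDimensional k R] :
    FdBimod k R :=
  ⟨dualBimod k R, inferInstanceAs (FiniteDimensional k (Module.Dual k R))⟩

namespace Bialgebroid

variable (H : Bialgebroid k R B)

/-- The property of being finite-dimensional, for `B`-modules. -/
def finDim : ObjectProperty H.Mod := fun M => FiniteDimensional k (H.forget.obj M).carrier

instance [FiniteDimensional k R] : H.finDim.IsMonoidal where
  prop_unit := inferInstanceAs (FiniteDimensional k R)
  prop_tensor M N (_ : FiniteDimensional k (H.forget.obj M).carrier)
      (_ : FiniteDimensional k (H.forget.obj N).carrier) :=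
    finiteDimensional_tensor (H.forget.obj M) (H.forget.obj N)

/-- The monoidal category of finite-dimensional `B`-modules. -/
abbrev FdMod : Type (u + 1) := H.finDim.FullSubcategory

/-- The forgetful functor from finite-dimensional `B`-modules to finite-dimensional bimodules. -/
def forgetFd : H.FdMod ⥤ FdBimod k R :=
  (finDimBimod k R).lift (H.finDim.ι ⋙ H.forget) fun M => M.property

/-- The monoidal structure of the forgetful functor. -/
def forgetFdCore [FiniteDimensional k R] : H.forgetFd.CoreMonoidal where
  εIso := (finDimBimod k R).isoMk H.eta
  μIso M N := (finDimBimod k R).isoMk (H.mu M.obj N.obj)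
  μIso_hom_natural_left f N := ObjectProperty.hom_ext _
    ((Monoidal.fromInducedCoreMonoidal H.forget H.inducing).μIso_hom_natural_left f.hom N.obj)
  μIso_hom_natural_right M f := ObjectProperty.hom_ext _
    ((Monoidal.fromInducedCoreMonoidal H.forget H.inducing).μIso_hom_natural_right M.obj f.hom)
  associativity M N P := ObjectProperty.hom_ext _
    ((Monoidal.fromInducedCoreMonoidal H.forget H.inducing).associativity M.obj N.obj P.obj)
  left_unitality M := ObjectProperty.hom_ext _
    ((Monoidal.fromInducedCoreMonoidal H.forget H.inducing).left_unitality M.obj)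
  right_unitality M := ObjectProperty.hom_ext _
    ((Monoidal.fromInducedCoreMonoidal H.forget H.inducing).right_unitality M.obj)

instance [FiniteDimensional k R] : H.forgetFd.Monoidal := H.forgetFdCore.toMonoidal

end Bialgebroid

/-- A full `R`-Hopf algebroid: a `×_R`-bialgebra together with an antipode. In both antipode axioms
`∑ i, a i ⊗ c i` is an arbitrary representative of `comul b = b₁ ⊗ b₂`; they read
`S(b₁)₁ b₂ ⊗ S(b₁)₂ = 1 ⊗ S(b)` and `S⁻¹(b₂)₁ ⊗ S⁻¹(b₂)₂ b₁ = S⁻¹(b) ⊗ 1`. -/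
structure FullHopfAlgebroid (k R B : Type u) [Field k] [Ring R] [Algebra k R] [Ring B]
    [Algebra k B] extends Bialgebroid k R B where
  S : B ≃ₐ[k] Bᵐᵒᵖ
  S_t : ∀ r : R, unop (S (t (op r))) = s r
  antipode : ∀ (b : B) (n : ℕ) (a c : Fin n → B),
    toCoring.comul b = ∑ i, toSourceTarget.cls (a i ⊗ₜ c i) →
    ∑ i, (toSourceTarget.rightMul (c i) ▷ toSourceTarget.eB).lin
        (toCoring.comul (unop (S (a i)))) =
      toSourceTarget.cls (1 ⊗ₜ unop (S b))
  antipode_symm : ∀ (b : B) (n : ℕ) (a c : Fin n → B),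
    toCoring.comul b = ∑ i, toSourceTarget.cls (a i ⊗ₜ c i) →
    ∑ i, (toSourceTarget.eB ◁ toSourceTarget.rightMul (a i)).lin
        (toCoring.comul (S.symm (op (c i)))) =
      toSourceTarget.cls (S.symm (op b) ⊗ₜ 1)

namespace FullHopfAlgebroid

variable (H : FullHopfAlgebroid k R B)

/-- The action of `B` on the dual of `R` induced by the antipode: `(b f) r = f (S b . r)`, where
`b . r = counit (b * s r)` is the canonical action of `B` on `R`. -/
def dualAct : B →ₐ[k] Module.End k (Module.Dual k R) :=
  AlgHom.ofLinearMap
    (Module.Dual.transpose ∘ₗ H.unitHom.toLinearMap ∘ₗ (opLinearEquiv k).symm.toLinearMap ∘ₗ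
      H.S.toLinearMap)
    (by ext; simp [Module.Dual.transpose_apply]) (fun x y => by ext; simp [Module.Dual.transpose_apply])

theorem dualAct_apply (b : B) (f : Module.Dual k R) (r : R) :
    H.dualAct b f r = f (H.counit (unop (H.S b) * H.s r)) := rfl

/-- The dual of `R` with the action of `B` induced by the antipode. -/
def dualMod : H.Mod := (⟨Module.Dual k R, H.dualAct⟩ : AlgMod k B)

/-- The dual of `R`, as a finite-dimensional `B`-module. -/
def dualFdMod [FiniteDimensional k R] : H.FdMod :=
  ⟨H.dualMod, inferInstanceAs (FiniteDimensional k (Module.Dual k R))⟩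

end FullHopfAlgebroid

end

end HopfGV

end

/-! Everything rests on one observation. Let `K` be `R^*` with the action through the antipode.
Evaluation at `1` turns a module map `M ⊗ N ⟶ K` into a `k`-bilinear form `l` on `M × N` with `l (b
m) n = l m (S(b) n)`, and every such form arises from exactly one map. Nothing is lost by evaluating
at `1`, because the value of a map at `r` is its value at `1` after `t(r)` acts on `n`. The antipode
axioms give both directions. Applying the counit to the first yields `∑ S(b₁) b₂ = t(ε(S(b)))`,
which makes the map built from a form linear (`exists_lin_of_form`). The second gives the adjunction
identity (`apply_S_symm`).

For bimodules the same holds with `B` replaced by the enveloping algebra and `S` by `x ⊗ op y ↦ y ⊗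
op (θ x)`, where `R^*` carries its left action twisted by an automorphism `θ` (`twistedDualForms`).
The canonical dual is `θ = id`. The underlying bimodule of `K` is `θ z = ε(S(s(z)))`, because the
first antipode axiom forces `S(s(z)) = t(θ z)` (`S_s`).

`AdjointForms` isolates this common situation. The linear dual with action through the
anti-automorphism or its inverse supplies perfect forms, and a pairing into `K` is universal, on
either side, exactly when its form is perfect. Such pairings show that `K` is dualizing, and they
produce all internal homs: if `q` is a universal pairing of `Y` into `K`, then `V ⊗ X ⟶ Y` is an
internal hom exactly when its composite with `q` is a universal pairing into `K`
(`isLeftUniversal_comp_iff`).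

Perfection of a form does not see which algebra acts, and the forgetful functor leaves the form
unchanged. It therefore preserves universal pairings into `K`, hence internal homs. Strictness and
the final equality criterion compare actions on a fixed vector space. -/

noncomputable section

namespace HopfGV

/-! ### Universal pairings, internal homs and dualizing objects. -/

section Universal

variable {C D : Type*} [Category C] [Category D] [MonoidalCategory C] [MonoidalCategory D]

/-- `p : V ⊗ Z ⟶ Y` exhibits `V` as an internal hom from `Z` to `Y`. -/
def IsLeftUniversal {V Z Y : C} (p : V ⊗ Z ⟶ Y) : Prop :=
  ∀ T : C, Function.Bijective fun h : T ⟶ V => h ▷ Z ≫ p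

/-- `p : V ⊗ Z ⟶ Y` exhibits `Z` as an internal hom from `V` to `Y`. -/
def IsRightUniversal {V Z Y : C} (p : V ⊗ Z ⟶ Y) : Prop :=
  ∀ T : C, Function.Bijective fun h : T ⟶ Z => V ◁ h ≫ p

/-- Since `q` represents `Hom(- ⊗ W, K)`, maps `T ⊗ X ⟶ Y` are the same as maps `T ⊗ (X ⊗ W) ⟶ K`,
and this bijection carries one universality map to the other. It reduces questions about arbitrary
internal homs to pairings into the single object `K`. -/
theorem isLeftUniversal_comp_iff {V X Y W K : C} (e : V ⊗ X ⟶ Y) {q : Y ⊗ W ⟶ K}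
    (hq : IsLeftUniversal q) :
    IsLeftUniversal ((α_ V X W).inv ≫ e ▷ W ≫ q) ↔ IsLeftUniversal e := by
  refine forall_congr' fun T => ?_
  let E : (T ⊗ X ⟶ Y) ≃ (T ⊗ X ⊗ W ⟶ K) :=
    (Equiv.ofBijective _ (hq (T ⊗ X))).trans ((α_ T X W).homFromEquiv)
  have : (fun h : T ⟶ V => h ▷ (X ⊗ W) ≫ (α_ V X W).inv ≫ e ▷ W ≫ q) =
      E ∘ fun h : T ⟶ V => h ▷ X ≫ e := by
    funext h
    simp [E, Iso.homFromEquiv]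
  rw [this]
  exact E.comp_bijective _

theorem isRightUniversal_comp_iff {V X Y W K : C} (e : X ⊗ V ⟶ Y) {q : W ⊗ Y ⟶ K}
    (hq : IsRightUniversal q) :
    IsRightUniversal ((α_ W X V).hom ≫ W ◁ e ≫ q) ↔ IsRightUniversal e := by
  refine forall_congr' fun T => ?_
  let E : (X ⊗ T ⟶ Y) ≃ ((W ⊗ X) ⊗ T ⟶ K) :=
    (Equiv.ofBijective _ (hq (X ⊗ T))).trans ((α_ W X T).symm.homFromEquiv)
  have : (fun h : T ⟶ V => (W ⊗ X) ◁ h ≫ (α_ W X V).hom ≫ W ◁ e ≫ q) =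
      E ∘ fun h : T ⟶ V => X ◁ h ≫ e := by
    funext h
    simp [E, Iso.homFromEquiv]
  rw [this]
  exact E.comp_bijective _

theorem isLeftUniversal_counit {X : C} {G : C ⥤ C} (adj : tensorRight X ⊣ G) (Y : C) :
    IsLeftUniversal (Y := Y) (V := G.obj Y) (Z := X) (adj.counit.app Y) := fun T => by
  have : (fun h : T ⟶ G.obj Y => h ▷ X ≫ adj.counit.app Y) = (adj.homEquiv T Y).symm := by
    funext h
    exact (adj.homEquiv_counit _ _ _).symm
  rw [this]
  exact Equiv.bijective _

theorem isRightUniversal_counit {X : C} {G : C ⥤ C} (adj : tensorLeft X ⊣ G) (Y : C) :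
    IsRightUniversal (Y := Y) (V := X) (Z := G.obj Y) (adj.counit.app Y) := fun T => by
  have : (fun h : T ⟶ G.obj Y => X ◁ h ≫ adj.counit.app Y) = (adj.homEquiv T Y).symm := by
    funext h
    exact (adj.homEquiv_counit _ _ _).symm
  rw [this]
  exact Equiv.bijective _

/-- By Yoneda: composition with this map, followed by the inverse of the adjunction bijection, is
the universality map of `e`. The right internal hom comparator has exactly this form. -/
theorem isIso_of_isLeftUniversal {X V Y : C} {G : C ⥤ C} (adj : tensorRight X ⊣ G)
    (e : V ⊗ X ⟶ Y) (he : IsLeftUniversal e) :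
    IsIso (adj.unit.app V ≫ G.map e) := by
  rw [isIso_iff_yoneda_map_bijective]
  intro T
  have : (fun h : T ⟶ V => h ≫ adj.unit.app V ≫ G.map e) =
      (adj.homEquiv T Y) ∘ fun h : T ⟶ V => h ▷ X ≫ e := by
    funext h
    have : h ≫ adj.unit.app V = adj.unit.app T ≫ G.map (h ▷ X) := (adj.unit_naturality h).symm
    rw [reassoc_of% this, ← G.map_comp]
    exact (adj.homEquiv_unit _ _ _).symm
  refine Eq.mpr (congrArg _ this) ?_
  exact (Equiv.bijective _).comp (he T)

theorem isIso_of_isRightUniversal {X V Y : C} {G : C ⥤ C} (adj : tensorLeft X ⊣ G)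
    (e : X ⊗ V ⟶ Y) (he : IsRightUniversal e) :
    IsIso (adj.unit.app V ≫ G.map e) := by
  rw [isIso_iff_yoneda_map_bijective]
  intro T
  have : (fun h : T ⟶ V => h ≫ adj.unit.app V ≫ G.map e) =
      (adj.homEquiv T Y) ∘ fun h : T ⟶ V => X ◁ h ≫ e := by
    funext h
    have : h ≫ adj.unit.app V = adj.unit.app T ≫ G.map (X ◁ h) := (adj.unit_naturality h).symm
    rw [reassoc_of% this, ← G.map_comp]
    exact (adj.homEquiv_unit _ _ _).symm
  refine Eq.mpr (congrArg _ this) ?_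
  exact (Equiv.bijective _).comp (he T)

theorem isLeftUniversal_whiskerLeft_iso {V Z Z' Y : C} {p : V ⊗ Z ⟶ Y} (hp : IsLeftUniversal p)
    (i : Z' ≅ Z) : IsLeftUniversal (V ◁ i.hom ≫ p) := fun T => by
  have : (fun h : T ⟶ V => h ▷ Z' ≫ V ◁ i.hom ≫ p) =
      (whiskerLeftIso T i).symm.homFromEquiv ∘ fun h : T ⟶ V => h ▷ Z ≫ p := by
    funext h
    simp [Iso.homFromEquiv, whisker_exchange_assoc]
  rw [this]
  exact (Equiv.bijective _).comp (hp T)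

theorem isRightUniversal_whiskerRight_iso {V V' Z Y : C} {p : V ⊗ Z ⟶ Y}
    (hp : IsRightUniversal p) (i : V' ≅ V) : IsRightUniversal (i.hom ▷ Z ≫ p) := fun T => by
  have : (fun h : T ⟶ Z => V' ◁ h ≫ i.hom ▷ Z ≫ p) =
      (whiskerRightIso i T).symm.homFromEquiv ∘ fun h : T ⟶ Z => V ◁ h ≫ p := by
    funext h
    simp [Iso.homFromEquiv, whisker_exchange_assoc]
  rw [this]
  exact (Equiv.bijective _).comp (hp T)

/-- Every object takes part, on either side, in a pairing into `K` that is universal on both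
sides. -/
structure HasUniversalPairings (K : C) : Prop where
  left : ∀ Z : C, ∃ (V : C) (p : V ⊗ Z ⟶ K), IsLeftUniversal p ∧ IsRightUniversal p
  right : ∀ V : C, ∃ (Z : C) (p : V ⊗ Z ⟶ K), IsLeftUniversal p ∧ IsRightUniversal p

namespace HasUniversalPairings

variable {K : C}

/-- With `W` paired to `Y`, the internal hom from `X` to `Y` is the partner `V` of `W ⊗ X`, or of `X
⊗ W` on the other side. Its evaluation is found by factoring the pairing of `V` through `q`. -/
theorem isClosedMonoidal (hK : HasUniversalPairings K) : IsClosedMonoidal C := fun X => by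
  constructor
  · have h : ∀ Y : C, ∃ (V : C) (e : X ⊗ V ⟶ Y), IsRightUniversal e := fun Y => by
      obtain ⟨W, q, -, hq⟩ := hK.left Y
      obtain ⟨V, p, -, hp⟩ := hK.right (W ⊗ X)
      -- The evaluation `e` is the map whose composite with `q` is the reassociated `p`, so the
      -- composition criterion applies backwards.
      obtain ⟨e, he⟩ := (hq (X ⊗ V)).2 ((α_ W X V).inv ≫ p)
      refine ⟨V, e, (isRightUniversal_comp_iff e hq).1 ?_⟩
      simp only at he
      rw [he]
      simpa using hp
    choose V e he using h
    exact (Adjunction.adjunctionOfEquivRight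
      (e := fun T Y => (Equiv.ofBijective _ (he Y T)).symm) (fun T' T Y f g => by
        rw [Equiv.symm_apply_eq]
        obtain ⟨h, rfl⟩ := (Equiv.ofBijective _ (he Y T)).surjective g
        rw [Equiv.symm_apply_apply]
        simp)).isLeftAdjoint
  · have h : ∀ Y : C, ∃ (V : C) (e : V ⊗ X ⟶ Y), IsLeftUniversal e := fun Y => by
      obtain ⟨W, q, hq, -⟩ := hK.right Y
      obtain ⟨V, p, hp, -⟩ := hK.left (X ⊗ W)
      obtain ⟨e, he⟩ := (hq (V ⊗ X)).2 ((α_ V X W).hom ≫ p)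
      refine ⟨V, e, (isLeftUniversal_comp_iff e hq).1 ?_⟩
      simp only at he
      rw [he]
      simpa using hp
    choose V e he using h
    exact (Adjunction.adjunctionOfEquivRight
      (e := fun T Y => (Equiv.ofBijective _ (he Y T)).symm) (fun T' T Y f g => by
        rw [Equiv.symm_apply_eq]
        obtain ⟨h, rfl⟩ := (Equiv.ofBijective _ (he Y T)).surjective g
        rw [Equiv.symm_apply_apply]
        simp)).isLeftAdjoint

/-- Left universality of the chosen pairings gives representability and the functor. Their right
universality makes it fully faithful, and the pairings from `hK.right` make it essentially
surjective. -/
theorem isDualizing (hK : HasUniversalPairings K) : IsDualizing K := by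
  choose V p hl hr using hK.left
  let E : ∀ X Y : C, (X ⟶ V Y) ≃ (X ⊗ Y ⟶ K) := fun X Y => Equiv.ofBijective _ (hl Y X)
  have hE : ∀ {X Y : C} (f : X ⟶ V Y), E X Y f = f ▷ Y ≫ p Y := fun _ => rfl
  have hE' : ∀ {X Y : C} (g : X ⊗ Y ⟶ K), (E X Y).symm g ▷ Y ≫ p Y = g := fun g =>
    (E _ _).apply_symm_apply g
  let F : Cᵒᵖ ⥤ C :=
    { obj Y := V Y.unop
      map {Y Y'} h := (E _ _).symm (V Y.unop ◁ h.unop ≫ p Y.unop)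
      map_id Y := by
        rw [Equiv.symm_apply_eq, hE]
        simp
      map_comp {Y Y' Y''} h h' := by
        rw [Equiv.symm_apply_eq, hE]
        simp only [comp_whiskerRight, Category.assoc, unop_comp, hE']
        rw [← whisker_exchange_assoc, hE']
        simp }
  refine ⟨F, fun X Y => (E X Y).symm, fun X X' Y f g => ?_, fun X Y Y' h g => ?_, ?_⟩
  · rw [Equiv.symm_apply_eq, hE, comp_whiskerRight, Category.assoc, hE']
  · obtain ⟨g, rfl⟩ := (E _ _).surjective g
    rw [Equiv.symm_apply_eq, Equiv.symm_apply_apply, hE, hE, comp_whiskerRight, Category.assoc]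
    simp only [F, hE', whisker_exchange_assoc, Quiver.Hom.unop_op]
  -- The functor on morphisms is the right universality bijection of `p Y` followed by the inverse
  -- of the left one of `p Y'`.
  · have hF : ∀ Y Y' : Cᵒᵖ, Function.Bijective fun h : Y ⟶ Y' => F.map h := fun Y Y' =>
      ((E _ _).symm.bijective.comp (hr Y.unop Y'.unop)).comp
        (Quiver.Hom.opEquiv (X := Y'.unop) (Y := Y.unop)).symm.bijective
    have : F.Faithful := ⟨fun {Y Y'} _ _ h => (hF Y Y').1 h⟩
    have : F.Full := ⟨fun {Y Y'} => (hF Y Y').2⟩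
    -- If `q : X ⊗ Z ⟶ K` is left universal, then `X` and `V Z` both represent `Hom(- ⊗ Z, K)`, so
    -- they are isomorphic.
    have : F.EssSurj := ⟨fun X => by
      obtain ⟨Z, q, hq, -⟩ := hK.right X
      obtain ⟨g, hg⟩ := (hq (V Z)).2 (p Z)
      simp only at hg
      refine ⟨Opposite.op Z, ⟨⟨g, (E X Z).symm q, ?_, ?_⟩⟩⟩
      · refine (hl Z _).1 ?_
        simp [hE', hg]
      · refine (hq _).1 ?_
        simp [hE', hg]⟩
    exact ⟨inferInstance, inferInstance, inferInstance⟩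

/-- A monoidal functor taking universal pairings into `K` to universal pairings is closed. -/
theorem isClosedFunctor (hK : HasUniversalPairings K) (F : C ⥤ D) [F.Monoidal]
    (hD : IsClosedMonoidal D)
    (hl : ∀ {X Y : C} (p : X ⊗ Y ⟶ K), IsLeftUniversal p →
      IsLeftUniversal (Functor.LaxMonoidal.μ F X Y ≫ F.map p))
    (hr : ∀ {X Y : C} (p : X ⊗ Y ⟶ K), IsRightUniversal p →
      IsRightUniversal (Functor.LaxMonoidal.μ F X Y ≫ F.map p)) :
    IsClosedFunctor F := by
  refine ⟨hK.isClosedMonoidal, hD, fun X Y G G' adj adj' => ?_, fun X Y G G' adj adj' => ?_⟩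
  · refine isIso_of_isRightUniversal adj' _ ?_
    -- The hypotheses on `F` concern only pairings into `K`. The evaluation is therefore composed
    -- with `q` in the source, transported by `F`, and freed of `q` again in the target; `μIso`
    -- replaces `F (W ⊗ X)` by `F W ⊗ F X`.
    obtain ⟨W, q, -, hq⟩ := hK.left Y
    have he := isRightUniversal_whiskerRight_iso
      (hr _ ((isRightUniversal_comp_iff _ hq).2 (isRightUniversal_counit adj Y)))
      (Functor.Monoidal.μIso F W X)
    refine (isRightUniversal_comp_iff _ (hr q hq)).1 ?_
    convert he using 1
    simp only [Functor.Monoidal.μIso_hom, Functor.map_comp, MonoidalCategory.whiskerLeft_comp,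
      Category.assoc, Functor.LaxMonoidal.associativity_assoc,
      ← Functor.LaxMonoidal.μ_natural_right_assoc]
  · refine isIso_of_isLeftUniversal adj' _ ?_
    obtain ⟨W, q, hq, -⟩ := hK.right Y
    have he := isLeftUniversal_whiskerLeft_iso
      (hl _ ((isLeftUniversal_comp_iff _ hq).2 (isLeftUniversal_counit adj Y)))
      (Functor.Monoidal.μIso F X W)
    refine (isLeftUniversal_comp_iff _ (hl q hq)).1 ?_
    convert he using 1
    simp only [Functor.Monoidal.μIso_hom, Functor.map_comp, comp_whiskerRight,
      Category.assoc, Functor.LaxMonoidal.associativity_inv_assoc,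
      ← Functor.LaxMonoidal.μ_natural_left_assoc]

end HasUniversalPairings

end Universal

/-! ### Perfect forms are the universal pairings. -/

section Forms

variable {k A : Type u} [Field k] [Ring A] [Algebra k A]

theorem AlgMod.bijective_lin {V W : AlgMod k A} (f : V ⟶ W) [IsIso f] :
    Function.Bijective f.lin :=
  Function.bijective_iff_has_inverse.2 ⟨(inv f).lin,
    LinearMap.congr_fun (congrArg AlgMod.Hom.lin (IsIso.hom_inv_id f)),
    LinearMap.congr_fun (congrArg AlgMod.Hom.lin (IsIso.inv_hom_id f))⟩

/-- The dual space of a module, with `A` acting through an anti-homomorphism. -/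
def AlgMod.dual (V : AlgMod k A) (σ : A →ₐ[k] Aᵐᵒᵖ) : AlgMod k A where
  carrier := Module.Dual k V.carrier
  act := AlgHom.ofLinearMap
    (Module.Dual.transpose ∘ₗ V.act.toLinearMap ∘ₗ (opLinearEquiv k).symm.toLinearMap ∘ₗ
      σ.toLinearMap)
    (by ext; simp [Module.Dual.transpose_apply])
    (fun x y => by ext; simp [Module.Dual.transpose_apply])

/-- The category `C` of finite-dimensional `A`-modules has a monoidal structure for which maps
`X ⊗ Y ⟶ K` are bilinear forms on `X × Y` for which `σ a` is adjoint to `a`. -/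
structure AdjointForms (σ : A ≃ₐ[k] Aᵐᵒᵖ) {C : Type*} [Category C] [MonoidalCategory C]
    (U : C ⥤ AlgMod k A) (K : C) where
  finiteDimensional : ∀ X : C, FiniteDimensional k (U.obj X).carrier
  exists_obj : ∀ V : AlgMod k A, FiniteDimensional k V.carrier → ∃ X : C, U.obj X = V
  form : ∀ {X Y : C}, (X ⊗ Y ⟶ K) →
    ((U.obj X).carrier →ₗ[k] (U.obj Y).carrier →ₗ[k] k)
  form_injective : ∀ {X Y : C}, Function.Injective (form (X := X) (Y := Y))
  form_act : ∀ {X Y : C} (p : X ⊗ Y ⟶ K) (a : A) (x y),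
    form p ((U.obj X).act a x) y = form p x ((U.obj Y).act (unop (σ a)) y)
  exists_form : ∀ {X Y : C} (l : (U.obj X).carrier →ₗ[k] (U.obj Y).carrier →ₗ[k] k),
    (∀ a x y, l ((U.obj X).act a x) y = l x ((U.obj Y).act (unop (σ a)) y)) →
      ∃ p : X ⊗ Y ⟶ K, form p = l
  form_whiskerRight : ∀ {X X' Y : C} (f : X' ⟶ X) (p : X ⊗ Y ⟶ K) (x y),
    form (f ▷ Y ≫ p) x y = form p ((U.map f).lin x) y
  form_whiskerLeft : ∀ {X Y Y' : C} (f : Y' ⟶ Y) (p : X ⊗ Y ⟶ K) (x y),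
    form (X ◁ f ≫ p) x y = form p x ((U.map f).lin y)

namespace AdjointForms

variable {σ : A ≃ₐ[k] Aᵐᵒᵖ} {C : Type*} [Category C] [MonoidalCategory C]
  {U : C ⥤ AlgMod k A} {K : C} (Φ : AdjointForms σ U K)

/-- The partner is the linear dual of `Z` with action through `σ`, paired by evaluation; the
required adjointness is then the definition of the action. -/
theorem exists_isPerfPair_left (Z : C) : ∃ (V : C) (p : V ⊗ Z ⟶ K), (Φ.form p).IsPerfPair := by
  have := Φ.finiteDimensional Z
  obtain ⟨V, hV⟩ := Φ.exists_obj ((U.obj Z).dual σ)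
    (inferInstanceAs (FiniteDimensional k (Module.Dual k _)))
  -- Form, perfection and adjointness are bundled in one existential, so that rewriting by `hV`
  -- changes the carrier in all three at once.
  have h : ∃ l : (U.obj V).carrier →ₗ[k] (U.obj Z).carrier →ₗ[k] k, l.IsPerfPair ∧
      ∀ a x y, l ((U.obj V).act a x) y = l x ((U.obj Z).act (unop (σ a)) y) := by
    rw [hV]
    exact ⟨LinearMap.id (R := k) (M := Module.Dual k (U.obj Z).carrier),
      inferInstanceAs (LinearMap.id (R := k) (M := Module.Dual k (U.obj Z).carrier)).IsPerfPair, fun _ _ _ => rfl⟩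
  obtain ⟨l, hl, ha⟩ := h
  obtain ⟨p, rfl⟩ := Φ.exists_form l ha
  exact ⟨V, p, hl⟩

theorem exists_isPerfPair_right (V : C) : ∃ (Z : C) (p : V ⊗ Z ⟶ K), (Φ.form p).IsPerfPair := by
  have := Φ.finiteDimensional V
  -- On this side the dual must carry the action through the inverse of `σ`: adjointness requires `τ
  -- (σ a)` to act as `a`. This uses the invertibility of the antipode.
  let τ : A →ₐ[k] Aᵐᵒᵖ := (AlgEquiv.opComm σ).symm
  obtain ⟨Z, hZ⟩ := Φ.exists_obj ((U.obj V).dual τ)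
    (inferInstanceAs (FiniteDimensional k (Module.Dual k _)))
  have h : ∃ l : (U.obj V).carrier →ₗ[k] (U.obj Z).carrier →ₗ[k] k, l.IsPerfPair ∧
      ∀ a x y, l ((U.obj V).act a x) y = l x ((U.obj Z).act (unop (σ a)) y) := by
    rw [hZ]
    refine ⟨Module.Dual.eval k (U.obj V).carrier,
      inferInstanceAs (Module.Dual.eval k (U.obj V).carrier).IsPerfPair, fun a x y => ?_⟩
    have hτ : unop (τ (unop (σ a))) = a := by simp [τ]
    change (show Module.Dual k (U.obj V).carrier from y) _ =
      (show Module.Dual k (U.obj V).carrier from y) ((U.obj V).act (unop (τ (unop (σ a)))) x)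
    rw [hτ]
  obtain ⟨l, hl, ha⟩ := h
  obtain ⟨p, rfl⟩ := Φ.exists_form l ha
  exact ⟨Z, p, hl⟩

section

variable [U.Full] [U.Faithful] {V Z : C} {p : V ⊗ Z ⟶ K}

/-- Perfection identifies `V` with the linear dual of `Z`, so any form on `T × Z` factors through a
unique linear map `T → V`. That map is `A`-linear because `σ a` is adjoint to `a` for both forms. -/
theorem isLeftUniversal_of_isPerfPair (hp : (Φ.form p).IsPerfPair) : IsLeftUniversal p := by
  intro T
  constructor
  · intro f g h
    refine U.map_injective (AlgMod.hom_ext (LinearMap.ext fun t => ?_))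
    refine hp.bijective_left.1 (LinearMap.ext fun z => ?_)
    rw [← Φ.form_whiskerRight, ← Φ.form_whiskerRight]
    exact congrArg (fun q => Φ.form q t z) h
  · intro q
    let e := (Φ.form p).toPerfPair
    have he : ∀ t z, Φ.form p (e.symm (Φ.form q t)) z = Φ.form q t z := fun t z =>
      LinearMap.congr_fun (e.apply_symm_apply (Φ.form q t)) z
    let f : U.obj T ⟶ U.obj V := ⟨e.symm.toLinearMap ∘ₗ Φ.form q, fun a t => by
      refine hp.bijective_left.1 (LinearMap.ext fun z => ?_)
      simp only [LinearMap.comp_apply, LinearEquiv.coe_coe, Φ.form_act, he]⟩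
    obtain ⟨g, hg⟩ := U.map_surjective f
    refine ⟨g, Φ.form_injective (LinearMap.ext₂ fun t z => ?_)⟩
    simp only [Φ.form_whiskerRight, hg]
    exact he t z

theorem isRightUniversal_of_isPerfPair (hp : (Φ.form p).IsPerfPair) : IsRightUniversal p := by
  have hσ : ∀ a : A, unop (σ (σ.symm (op a))) = a := by simp
  intro T
  constructor
  · intro f g h
    refine U.map_injective (AlgMod.hom_ext (LinearMap.ext fun t => ?_))
    refine hp.bijective_right.1 (LinearMap.ext fun v => ?_)
    rw [LinearMap.flip_apply, LinearMap.flip_apply, ← Φ.form_whiskerLeft, ← Φ.form_whiskerLeft]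
    exact congrArg (fun q => Φ.form q v t) h
  · intro q
    let e := (Φ.form p).flip.toPerfPair
    have he : ∀ v t, Φ.form p v (e.symm ((Φ.form q).flip t)) = Φ.form q v t := fun v t =>
      LinearMap.congr_fun (e.apply_symm_apply ((Φ.form q).flip t)) v
    let f : U.obj T ⟶ U.obj Z := ⟨e.symm.toLinearMap ∘ₗ (Φ.form q).flip, fun a t => by
      refine hp.bijective_right.1 (LinearMap.ext fun v => ?_)
      -- Moving `a` from the second variable to the first requires writing it as `σ` of its
      -- preimage.
      have h₁ := Φ.form_act q (σ.symm (op a)) v t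
      have h₂ := Φ.form_act p (σ.symm (op a)) v (e.symm ((Φ.form q).flip t))
      rw [hσ] at h₁ h₂
      simp only [LinearMap.comp_apply, LinearEquiv.coe_coe, LinearMap.flip_apply, he] at h₂ ⊢
      rw [← h₁, h₂]⟩
    obtain ⟨g, hg⟩ := U.map_surjective f
    refine ⟨g, Φ.form_injective (LinearMap.ext₂ fun v t => ?_)⟩
    simp only [Φ.form_whiskerLeft, hg]
    exact he v t

/-- Universal objects are unique: some pairing with the same `Z` is perfect, hence universal, so `p`
differs from it by an isomorphism in the first variable, which preserves perfection. -/
theorem isPerfPair_of_isLeftUniversal (hp : IsLeftUniversal p) : (Φ.form p).IsPerfPair := by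
  obtain ⟨V', q, hq⟩ := Φ.exists_isPerfPair_left Z
  have hq' := Φ.isLeftUniversal_of_isPerfPair hq
  obtain ⟨f, hf⟩ := (hq' V).2 p
  obtain ⟨g, hg⟩ := (hp V').2 q
  simp only at hf hg
  have : IsIso f := ⟨g, (hp V).1 (by simp [hf, hg]), (hq' V').1 (by simp [hf, hg])⟩
  have := Φ.finiteDimensional Z
  refine .of_bijective _ ?_
  convert hq.bijective_left.comp (AlgMod.bijective_lin (U.map f)) using 1
  funext x
  refine LinearMap.ext fun z => ?_
  rw [← hf, Φ.form_whiskerRight, Function.comp_apply]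

theorem isPerfPair_of_isRightUniversal (hp : IsRightUniversal p) : (Φ.form p).IsPerfPair := by
  obtain ⟨Z', q, hq⟩ := Φ.exists_isPerfPair_right V
  have hq' := Φ.isRightUniversal_of_isPerfPair hq
  obtain ⟨f, hf⟩ := (hq' Z).2 p
  obtain ⟨g, hg⟩ := (hp Z').2 q
  simp only at hf hg
  have : IsIso f := ⟨g, (hp Z).1 (by simp [hf, hg]), (hq' Z').1 (by simp [hf, hg])⟩
  have := Φ.finiteDimensional V
  refine LinearMap.IsPerfPair.flip (p := (Φ.form p).flip) (.of_bijective _ ?_)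
  convert hq.bijective_right.comp (AlgMod.bijective_lin (U.map f)) using 1
  funext z
  refine LinearMap.ext fun v => ?_
  rw [LinearMap.flip_apply, ← hf, Φ.form_whiskerLeft, Function.comp_apply, LinearMap.flip_apply]

end

theorem hasUniversalPairings [U.Full] [U.Faithful] (Φ : AdjointForms σ U K) : HasUniversalPairings K where
  left Z := by
    obtain ⟨V, p, hp⟩ := Φ.exists_isPerfPair_left Z
    exact ⟨V, p, Φ.isLeftUniversal_of_isPerfPair hp, Φ.isRightUniversal_of_isPerfPair hp⟩
  right V := by
    obtain ⟨Z, p, hp⟩ := Φ.exists_isPerfPair_right V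
    exact ⟨Z, p, Φ.isLeftUniversal_of_isPerfPair hp, Φ.isRightUniversal_of_isPerfPair hp⟩

/-- Universality refers to different test objects in the two categories. Perfection is plain linear
algebra, so it carries universality across. -/
theorem isClosedFunctor {A' : Type u} [Ring A'] [Algebra k A'] {σ' : A' ≃ₐ[k] A'ᵐᵒᵖ}
    {C' : Type*} [Category C'] [MonoidalCategory C'] {U' : C' ⥤ AlgMod k A'}
    [U.Full] [U.Faithful] [U'.Full] [U'.Faithful] (F : C ⥤ C') [F.Monoidal]
    (Φ' : AdjointForms σ' U' (F.obj K))
    (h : ∀ {X Y : C} (p : X ⊗ Y ⟶ K), (Φ.form p).IsPerfPair →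
      (Φ'.form (Functor.LaxMonoidal.μ F X Y ≫ F.map p)).IsPerfPair) : IsClosedFunctor F :=
  Φ.hasUniversalPairings.isClosedFunctor F Φ'.hasUniversalPairings.isClosedMonoidal
    (fun p hp => Φ'.isLeftUniversal_of_isPerfPair (h p (Φ.isPerfPair_of_isLeftUniversal hp)))
    (fun p hp => Φ'.isRightUniversal_of_isPerfPair (h p (Φ.isPerfPair_of_isRightUniversal hp)))

end AdjointForms

end Forms

open RBimod

/-! ### Forms valued in twisted dual bimodules of `R`. -/

section TwistedDual

variable {k R : Type u} [Field k] [Ring R] [Algebra k R]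

/-- The anti-automorphism `x ⊗ op y ↦ y ⊗ op (θ x)` of the enveloping algebra. -/
def envelopingTwist (θ : R ≃ₐ[k] R) : R ⊗[k] Rᵐᵒᵖ ≃ₐ[k] (R ⊗[k] Rᵐᵒᵖ)ᵐᵒᵖ :=
  ((Algebra.TensorProduct.comm k R Rᵐᵒᵖ).trans
    (Algebra.TensorProduct.congr AlgEquiv.refl (θ.trans (AlgEquiv.opOp k R)))).trans
      (Algebra.TensorProduct.opAlgEquiv k k R Rᵐᵒᵖ)

theorem unop_envelopingTwist_tmul (θ : R ≃ₐ[k] R) (x y : R) :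
    unop (envelopingTwist θ (x ⊗ₜ op y)) = y ⊗ₜ op (θ x) := by
  simp [envelopingTwist]

/-- A functional `f` satisfies `f r = (f.r) 1`, and the right action on `V ⊗ W` is that on `W`.
Hence the values at `1` determine the whole map. -/
theorem RBimod.tm_ract_form {V W K : RBimod k R} (ι : K.carrier ≃ₗ[k] Module.Dual k R)
    (hr : ∀ x f y, ι (K.ract (op x) f) y = ι f (x * y)) (φ : V ⊗ W ⟶ K)
    (v : V.carrier) (w : W.carrier) (r : R) :
    ι (φ.lin (tm v w)) r = ι (φ.lin (tm v (W.ract (op r) w))) 1 := by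
  have h := RBimod.hom_ract φ (op r) (tm v w)
  rw [show (V ⊗ W).ract (op r) (tm v w) = tm v (W.ract (op r) w) from ract_tm _ _ _] at h
  rw [h, hr, mul_one]

/-- Let `K` be the bimodule `R^*` with the structure `(z.f.x) y = f (x * y * θ z)`. Maps
`V ⊗ W ⟶ K` correspond to bilinear forms, through evaluation at `1`. -/
def twistedDualForms (θ : R ≃ₐ[k] R) (K : FdBimod k R) (ι : K.obj.carrier ≃ₗ[k] Module.Dual k R)
    [FiniteDimensional k R]
    (hl : ∀ z f y, ι (RBimod.lact K.obj z f) y = ι f (y * θ z))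
    (hr : ∀ x f y, ι (RBimod.ract K.obj (op x) f) y = ι f (x * y)) :
    AdjointForms (envelopingTwist θ) (finDimBimod k R).ι K where
  finiteDimensional X := X.property
  exists_obj V hV := ⟨⟨V, hV⟩, rfl⟩
  form {X Y} p := (tmₗ X.obj Y.obj).compr₂
    ((LinearMap.applyₗ (1 : R)) ∘ₗ ι.toLinearMap ∘ₗ p.hom.lin)
  form_injective {X Y} p q h := by
    refine ObjectProperty.hom_ext _ (tensor_hom_ext fun v w => ι.injective ?_)
    refine LinearMap.ext fun r => ?_
    refine (tm_ract_form ι hr p.hom v w r).trans (Eq.trans ?_ (tm_ract_form ι hr q.hom v w r).symm)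
    exact LinearMap.congr_fun₂ h v _
  form_act {X Y} p a x y := by
    induction a using TensorProduct.induction_on with
    | zero => simp only [map_zero, LinearMap.zero_apply, unop_zero]
    | tmul z w =>
      induction w using MulOpposite.rec' with
      | h w =>
        rw [unop_envelopingTwist_tmul]
        change ι (p.hom.lin (tm (AlgMod.act X.obj (z ⊗ₜ op w) x) y)) 1 =
          ι (p.hom.lin (tm x (AlgMod.act Y.obj (w ⊗ₜ op (θ z)) y))) 1
        have h := RBimod.hom_lact p.hom z (tm (X.obj.ract (op w) x) y)
        rw [show RBimod.lact (X ⊗ Y).obj z (tm (X.obj.ract (op w) x) y) =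
          tm (X.obj.lact z (X.obj.ract (op w) x)) y from lact_tm _ _ _] at h
        rw [RBimod.act_tmul, RBimod.act_tmul, h, hl, one_mul, tm_ract_form ι hr, tm_bal]
    | add a b ha hb =>
      rw [show unop (envelopingTwist θ (a + b)) =
        unop (envelopingTwist θ a) + unop (envelopingTwist θ b) from
          congrArg unop (map_add (envelopingTwist θ) a b)]
      simp only [map_add, LinearMap.add_apply, ha, hb]
  exists_form {X Y} l h := by
    have hz : ∀ z x y, l (X.obj.lact z x) y = l x (Y.obj.ract (op (θ z)) y) := fun z x y => by
      have := h (z ⊗ₜ 1) x y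
      rw [← op_one, unop_envelopingTwist_tmul] at this
      exact this
    have hw : ∀ w x y, l (X.obj.ract (op w) x) y = l x (Y.obj.lact w y) := fun w x y => by
      have := h (1 ⊗ₜ op w) x y
      rw [unop_envelopingTwist_tmul, map_one] at this
      exact this
    -- The formula `g x y r = l x (y.r)` is forced by `tm_ract_form`.
    let g : X.obj.carrier →ₗ[k] Y.obj.carrier →ₗ[k] Module.Dual k R :=
      LinearMap.mk₂ k (fun x y => l x ∘ₗ Y.obj.ract.toLinearMap.flip y ∘ₗ
          (opLinearEquiv k).toLinearMap)
        (fun _ _ _ => by ext; simp) (fun _ _ _ => by ext; simp)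
        (fun _ _ _ => by ext; simp) (fun _ _ _ => by ext; simp)
    have hg : ∀ x y r, g x y r = l x (Y.obj.ract (op r) y) := fun _ _ _ => rfl
    let φ : (tensor X.obj Y.obj).carrier →ₗ[k] K.obj.carrier :=
      RBimod.lift (g.compr₂ ι.symm.toLinearMap) (fun r v w => congrArg ι.symm
        (LinearMap.ext fun s => by
          have := LinearMap.congr_fun (RBimod.commute Y.obj r (op s)) w
          simp only [Module.End.mul_apply] at this
          rw [hg, hg, hw, this]))
    have hφ : ∀ x y, ι (φ (tm x y)) = g x y := fun x y =>
      (congrArg ι (lift_tm _ _ x y)).trans (ι.apply_symm_apply _)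
    refine ⟨ObjectProperty.homMk (homOfTensor φ (fun z v w => ι.injective (LinearMap.ext fun s => ?_))
      (fun z v w => ι.injective (LinearMap.ext fun s => ?_))), ?_⟩
    · rw [hl, hφ, hφ, hg, hg, hz, op_mul, map_mul, Module.End.mul_apply]
    · obtain ⟨z, rfl⟩ := op_surjective z
      rw [hr, hφ, hφ, hg, hg, op_mul, map_mul, Module.End.mul_apply]
    · refine LinearMap.ext₂ fun x y => ?_
      change ι (φ (tm x y)) 1 = _
      rw [hφ, hg, op_one, map_one, Module.End.one_apply]
  form_whiskerRight f p x y :=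
    congrArg (fun u => ι (p.hom.lin u) 1) (tensorMap_tm f.hom (𝟙 _) x y)
  form_whiskerLeft f p x y :=
    congrArg (fun u => ι (p.hom.lin u) 1) (tensorMap_tm (𝟙 _) f.hom x y)

end TwistedDual

/-! ### The antipode identities and forms on `B`-modules. -/

section

variable {k R B : Type u} [Field k] [Ring R] [Algebra k R] [Ring B] [Algebra k B]

namespace Bialgebroid

variable (H : Bialgebroid k R B)

theorem exists_comul_eq_sum (b : B) : ∃ (n : ℕ) (a c : Fin n → B),
    H.comul b = ∑ i, H.cls (a i ⊗ₜ c i) := by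
  obtain ⟨x, hx⟩ := H.cls_surjective (H.comul b)
  obtain ⟨n, a, c, rfl⟩ := TensorProduct.exists_sum_tmul_eq x
  exact ⟨n, a, c, by rw [← hx, map_sum]⟩

/-- The map `a ⊗ c ↦ t (counit c) * a`. -/
def counitRight : (H.eB ⊗ H.eB : RBimod k R) ⟶ H.eB :=
  H.eB ◁ (show H.eB ⟶ 𝟙_ (RBimod k R) from H.coalgebra.counit) ≫ (ρ_ H.eB).hom

theorem counitRight_cls (a c : B) :
    H.counitRight.lin (H.cls (a ⊗ₜ c)) = H.eBEquiv (H.t (op (H.counit c)) * a) := by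
  have h : (H.eB ◁ (show H.eB ⟶ 𝟙_ (RBimod k R) from H.coalgebra.counit)).lin
      (H.cls (a ⊗ₜ c)) = tm (H.eBEquiv a) (unitEquiv k R (H.counit c)) :=
    tensorMap_tm _ _ _ _
  rw [counitRight, lin_comp_apply, h, rightUnitor_tm]
  exact H.ract_res (AlgMod.regular k B) _ a

theorem counitRight_comul (b : B) : H.counitRight.lin (H.comul b) = H.eBEquiv b := by
  have h : H.coalgebra.comul ≫ H.counitRight = 𝟙 _ := by
    have := H.coalgebra.comul_counit
    rw [counitRight, reassoc_of% this, Iso.inv_hom_id]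
  exact LinearMap.congr_fun (congrArg AlgMod.Hom.lin h) (H.eBEquiv b)

theorem counitRight_rightMul (c : B) (z : (H.eB ⊗ H.eB : RBimod k R).carrier) :
    H.counitRight.lin ((H.rightMul c ▷ H.eB).lin z) =
      (H.rightMul c).lin (H.counitRight.lin z) := by
  rw [← lin_comp_apply, ← lin_comp_apply]
  congr 2
  rw [counitRight, ← whisker_exchange_assoc, Category.assoc, rightUnitor_naturality]

theorem sum_t_counit_mul (b : B) {n : ℕ} {a c : Fin n → B}
    (h : H.comul b = ∑ i, H.cls (a i ⊗ₜ c i)) : ∑ i, H.t (op (H.counit (c i))) * a i = b := by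
  apply H.eBEquiv.injective
  rw [← H.counitRight_comul b, h, map_sum, map_sum]
  simp only [counitRight_cls]

theorem actHom_tm (M N : AlgMod k B) (b : B) (m : (H.res.obj M).carrier)
    (n : (H.res.obj N).carrier) {j : ℕ} {a c : Fin j → B}
    (h : H.comul b = ∑ i, H.cls (a i ⊗ₜ c i)) :
    H.actHom M N b (tm m n) = ∑ i, tm (H.bact M (a i) m) (H.bact N (c i) n) := by
  refine (H.actLin_tm M N b m n).trans ?_
  rw [h, map_sum]
  simp only [orb_tensor_cls]

theorem actHom_t (M N : AlgMod k B) (r : R) (m : (H.res.obj M).carrier)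
    (n : (H.res.obj N).carrier) :
    H.actHom M N (H.t (op r)) (tm m n) = tm m (H.bact N (H.t (op r)) n) := by
  refine (H.actLin_tm M N _ m n).trans ?_
  rw [comul_t, orb_tensor_cls, map_one, Module.End.one_apply]

end Bialgebroid

namespace FullHopfAlgebroid

variable (H : FullHopfAlgebroid k R B)

/-- Apply the counit to the second tensor factor of the first antipode axiom. On the left the counit
law collapses `S(b₁)₁ b₂ ⊗ S(b₁)₂` to `S(b₁) b₂`; on the right `1 ⊗ S(b)` becomes `t(ε(S(b)))`. -/
theorem sum_S_mul (b : B) {n : ℕ} {a c : Fin n → B}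
    (h : H.comul b = ∑ i, H.cls (a i ⊗ₜ c i)) :
    ∑ i, unop (H.S (a i)) * c i = H.t (op (H.counit (unop (H.S b)))) := by
  have h' := congrArg H.counitRight.lin (H.antipode b n a c h)
  simp only [map_sum, Bialgebroid.counitRight_rightMul, Bialgebroid.counitRight_comul,
    Bialgebroid.counitRight_cls, SourceTarget.rightMul_lin, mul_one] at h'
  rw [← map_sum] at h'
  exact H.eBEquiv.injective h'

theorem dualAct_t_apply_one (r : R) (f : Module.Dual k R) :
    H.dualAct (H.t (op r)) f 1 = f r := by
  rw [dualAct_apply, H.S_t, map_one, mul_one, H.counit_s]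

section

variable {M N : AlgMod k B}
  (p : (tensor (H.res.obj M) (H.res.obj N)).carrier →ₗ[k] Module.Dual k R)
  (hp : ∀ b x, p (H.actHom M N b x) = H.dualAct b (p x))

include hp

/-- Since `S(t(r)) = s(r)`, acting by `t(r)` on `R^*` and evaluating at `1` gives evaluation at `r`,
while on `M ⊗ N` the element `t(r)` acts on the second factor only. -/
theorem apply_tm (m : (H.res.obj M).carrier) (n : (H.res.obj N).carrier) (r : R) :
    p (tm m n) r = p (tm m (H.bact N (H.t (op r)) n)) 1 := by
  rw [← H.dualAct_t_apply_one, ← hp, Bialgebroid.actHom_t]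

/-- The second antipode axiom writes `S⁻¹(b)m ⊗ n` as the sum of the `S⁻¹(b₂)(m ⊗ b₁n)`. Linearity
of `p` turns evaluation at `1` into evaluation of `p (m ⊗ b₁n)` at `ε(b₂)`, and the counit law `∑
t(ε(b₂)) b₁ = b` finishes. -/
theorem apply_S_symm (b : B) (m : (H.res.obj M).carrier) (n : (H.res.obj N).carrier) :
    p (tm (H.bact M (H.S.symm (op b)) m) n) 1 = p (tm m (H.bact N b n)) 1 := by
  obtain ⟨j, a, c, h⟩ := H.exists_comul_eq_sum b
  have h' := congrArg (H.orb M m ⊗ₘ H.orb N n).lin (H.antipode_symm b j a c h)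
  rw [Bialgebroid.orb_tensor_cls, map_one, Module.End.one_apply, map_sum] at h'
  rw [← h', map_sum, LinearMap.sum_apply]
  have hi : ∀ i, (H.orb M m ⊗ₘ H.orb N n).lin ((H.eB ◁ H.rightMul (a i)).lin
      (H.comul (H.S.symm (op (c i))))) =
      H.actHom M N (H.S.symm (op (c i))) (tm m (H.bact N (a i) n)) := fun i => by
    refine Eq.trans ?_ (H.actLin_tm M N _ m _).symm
    rw [← Bialgebroid.lin_comp_apply, ← Bialgebroid.rightMul_orb]
    simp [← MonoidalCategory.id_tensorHom]
  simp only [hi, hp, dualAct_apply, AlgEquiv.apply_symm_apply, unop_op, map_one, mul_one]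
  -- The argument `ε(b₂)` moves into the second tensor factor as `t(ε(b₂))`, where the sum can be
  -- contracted.
  simp only [H.apply_tm p hp _ _ (H.counit _)]
  rw [← LinearMap.sum_apply, ← map_sum]
  simp only [← tmₗ_apply_apply, ← map_sum, ← Module.End.mul_apply, ← map_mul]
  simp only [← LinearMap.sum_apply, ← map_sum]
  rw [H.sum_t_counit_mul b h]

end

/-- A bilinear form for which `S b` is adjoint to `b` is balanced, and gives a `B`-linear map
`m ⊗ n ↦ (r ↦ l m (t r n))` to the dual of `R`. -/
theorem exists_lin_of_form {M N : AlgMod k B}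
    (l : (H.res.obj M).carrier →ₗ[k] (H.res.obj N).carrier →ₗ[k] k)
    (hl : ∀ b m n, l (H.bact M b m) n = l m (H.bact N (unop (H.S b)) n)) :
    ∃ p : (tensor (H.res.obj M) (H.res.obj N)).carrier →ₗ[k] Module.Dual k R,
      (∀ b x, p (H.actHom M N b x) = H.dualAct b (p x)) ∧ ∀ m n, p (tm m n) 1 = l m n := by
  -- Balancedness is adjointness for `b = t(r)`, since `S(t(r)) = s(r)`.
  let L : (tensor (H.res.obj M) (H.res.obj N)).carrier →ₗ[k] k :=
    RBimod.lift l fun r m n => by rw [H.ract_res, H.lact_res, hl, H.S_t]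
  have hL : ∀ m n, L (tm m n) = l m n := fun m n => lift_tm _ _ _ _
  -- Adjointness moves every `b₁` to the right, where `∑ S(b₁) b₂` is known from `sum_S_mul`.
  have hact : ∀ b m n, L (H.actHom M N b (tm m n)) =
      l m (H.bact N (H.t (op (H.counit (unop (H.S b))))) n) := fun b m n => by
    obtain ⟨j, a, c, h⟩ := H.exists_comul_eq_sum b
    rw [H.actHom_tm M N b m n h, map_sum]
    simp only [hL, hl]
    rw [← map_sum]
    simp only [← Module.End.mul_apply, ← map_mul]
    rw [← LinearMap.sum_apply, ← map_sum, H.sum_S_mul b h]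
  let p : (tensor (H.res.obj M) (H.res.obj N)).carrier →ₗ[k] Module.Dual k R :=
    LinearMap.mk₂ k (fun x r => L (H.actHom M N (H.t (op r)) x))
      (fun _ _ _ => by simp) (fun _ _ _ => by simp) (fun _ _ _ => by simp) (fun _ _ _ => by simp)
  have hp : ∀ x r, p x r = L (H.actHom M N (H.t (op r)) x) := fun _ _ => rfl
  refine ⟨p, fun b x => ?_, fun m n => ?_⟩
  · have : p ∘ₗ H.actHom M N b = H.dualAct b ∘ₗ p := tensor_ext fun m n => by
      -- Both sides become `l m (t(ε(S(b) s(r))) n)`: on the left by `hact` for `t(r) b`, because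
      -- `S(t(r) b) = S(b) s(r)`.
      ext r
      rw [LinearMap.comp_apply, LinearMap.comp_apply, dualAct_apply, hp, hp,
        ← Module.End.mul_apply, ← map_mul, hact, Bialgebroid.actHom_t, hL, map_mul, unop_mul,
        H.S_t]
    exact LinearMap.congr_fun this x
  · rw [hp, op_one, map_one, map_one, Module.End.one_apply, hL]

/-- Finite-dimensional `B`-modules, as modules over the algebra `B`. -/
def toAlgMod : H.FdMod ⥤ AlgMod k B := H.finDim.ι

instance : H.toAlgMod.Full := inferInstanceAs H.finDim.ι.Full

instance : H.toAlgMod.Faithful := inferInstanceAs H.finDim.ι.Faithful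

/-- The linear map underlying a map of `B`-modules from a tensor product to the dual of `R`. -/
def linToDual [FiniteDimensional k R] {X Y : H.FdMod} (p : X ⊗ Y ⟶ H.dualFdMod) :
    (tensor (H.forget.obj X.obj) (H.forget.obj Y.obj)).carrier →ₗ[k] Module.Dual k R :=
  AlgMod.Hom.lin (V := H.tensorMod X.obj Y.obj) (W := ⟨Module.Dual k R, H.dualAct⟩) p.hom

theorem linToDual_act [FiniteDimensional k R] {X Y : H.FdMod} (p : X ⊗ Y ⟶ H.dualFdMod) (b : B)
    (x : (tensor (H.res.obj X.obj) (H.res.obj Y.obj)).carrier) :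
    H.linToDual p (H.actHom X.obj Y.obj b x) = H.dualAct b (H.linToDual p x) :=
  AlgMod.Hom.comm (V := H.tensorMod X.obj Y.obj) (W := ⟨Module.Dual k R, H.dualAct⟩) p.hom b x

theorem linToDual_injective [FiniteDimensional k R] {X Y : H.FdMod} :
    Function.Injective (H.linToDual (X := X) (Y := Y)) := fun _ _ h =>
  ObjectProperty.hom_ext _ (AlgMod.hom_ext (V := H.tensorMod X.obj Y.obj)
    (W := ⟨Module.Dual k R, H.dualAct⟩) h)

/-- Maps `M ⊗ N ⟶ R^*` of `B`-modules correspond to bilinear forms for which `S b` is adjoint to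
`b`, through evaluation at `1`. -/
def dualForms [FiniteDimensional k R] : AdjointForms H.S H.toAlgMod H.dualFdMod where
  finiteDimensional X := X.property
  exists_obj V hV := ⟨⟨V, hV⟩, rfl⟩
  form {X Y} p := (tmₗ (H.forget.obj X.obj) (H.forget.obj Y.obj)).compr₂
    (LinearMap.applyₗ (1 : R) ∘ₗ H.linToDual p)
  form_injective {X Y} p q h := by
    refine H.linToDual_injective (tensor_ext fun m n => LinearMap.ext fun r => ?_)
    refine (H.apply_tm _ (H.linToDual_act p) m n r).trans
      (Eq.trans ?_ (H.apply_tm _ (H.linToDual_act q) m n r).symm)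
    exact LinearMap.congr_fun₂ h m _
  form_act {X Y} p a x y := by
    have := H.apply_S_symm _ (H.linToDual_act p) (unop (H.S a)) x y
    rw [op_unop, AlgEquiv.symm_apply_apply] at this
    exact this
  exists_form {X Y} l h := by
    obtain ⟨p, hp, hpl⟩ := H.exists_lin_of_form l h
    exact ⟨ObjectProperty.homMk (AlgMod.Hom.mk (V := H.tensorMod X.obj Y.obj)
      (W := ⟨Module.Dual k R, H.dualAct⟩) p hp), LinearMap.ext₂ hpl⟩
  form_whiskerRight {X X' Y} f p x y :=
    congrArg (fun u => H.linToDual p u 1)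
      (tensorMap_tm (H.forget.map f.hom) (𝟙 (H.forget.obj Y.obj)) x y)
  form_whiskerLeft {X Y Y'} f p x y :=
    congrArg (fun u => H.linToDual p u 1)
      (tensorMap_tm (𝟙 (H.forget.obj X.obj)) (H.forget.map f.hom) x y)

end FullHopfAlgebroid

end

/-! ### Equalities of objects and identity morphisms. -/

section Equality

variable {k A : Type u} [Field k] [Ring A] [Algebra k A]

theorem AlgMod.act_eq_of_mk_eq {V : Type u} [AddCommGroup V] [Module k V]
    {a a' : A →ₐ[k] Module.End k V} (h : (⟨V, a⟩ : AlgMod k A) = ⟨V, a'⟩) : a = a' := by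
  injection h

/-- With the carrier fixed, the object equality reduces to an equality of actions, which can be
substituted without any transport of vectors. -/
theorem AlgMod.eq_eqToHom {V : Type u} [AddCommGroup V] [Module k V]
    {a a' : A →ₐ[k] Module.End k V} (h : (⟨V, a⟩ : AlgMod k A) = ⟨V, a'⟩)
    (f : (⟨V, a⟩ : AlgMod k A) ⟶ ⟨V, a'⟩) (hf : f.lin = LinearMap.id) : f = eqToHom h := by
  obtain rfl := AlgMod.act_eq_of_mk_eq h
  exact AlgMod.hom_ext hf

theorem fullSubcategory_eq {C : Type*} [Category C] {P : ObjectProperty C}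
    {X Y : P.FullSubcategory} (h : X.obj = Y.obj) : X = Y := by
  cases X
  cases Y
  cases h
  rfl

theorem fullSubcategory_eq_eqToHom {C : Type*} [Category C] {P : ObjectProperty C}
    {X Y : P.FullSubcategory} (h : X = Y) (f : X ⟶ Y)
    (hf : f.hom = eqToHom (congrArg (fun X => X.obj) h)) : f = eqToHom h := by
  cases h
  exact ObjectProperty.hom_ext _ hf

end Equality

/-! ### The twist `z ↦ ε(S(s(z)))`, strictness, closedness and the equality criterion. -/

section

variable {k R B : Type u} [Field k] [Ring R] [Algebra k R] [Ring B] [Algebra k B]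

theorem Bialgebroid.isStrictMonoidal_forgetFd [FiniteDimensional k R] (H : Bialgebroid k R B) :
    IsStrictMonoidal H.forgetFd where
  unit_eq := fullSubcategory_eq H.res_unitMod.symm
  tensor_eq M N := fullSubcategory_eq (H.res_tensorMod M.obj N.obj).symm
  ε_eq := fullSubcategory_eq_eqToHom _ _ (AlgMod.eq_eqToHom (V := R) H.res_unitMod.symm _ rfl)
  μ_eq M N := fullSubcategory_eq_eqToHom _ _
    (AlgMod.eq_eqToHom (a := (tensor (H.res.obj M.obj) (H.res.obj N.obj)).act)
      (a' := (H.actHom M.obj N.obj).comp H.e) (H.res_tensorMod M.obj N.obj).symm _ rfl)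

namespace FullHopfAlgebroid

variable (H : FullHopfAlgebroid k R B)

/-- Because `Δ(s(z)) = s(z) ⊗ 1`, the sum in `sum_S_mul` has the single term `S(s(z))`. Thus `S`
maps the image of `s` into that of `t`, which makes the twist multiplicative. -/
theorem S_s (z : R) : unop (H.S (H.s z)) = H.t (op (H.counit (unop (H.S (H.s z))))) := by
  have h : H.comul (H.s z) = ∑ i : Fin 1, H.cls ((fun _ => H.s z) i ⊗ₜ (fun _ => 1) i) := by
    simpa using H.comul_s z
  simpa using H.sum_S_mul _ h

theorem counit_t (r : R) : H.counit (H.t (op r)) = r := by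
  simpa [H.counit_one] using H.counit_t_mul r 1

/-- The algebra endomorphism `z ↦ counit (S (s z))` of `R`. -/
def nakayamaHom : R →ₐ[k] R :=
  AlgHom.ofLinearMap
    (H.counit ∘ₗ (opLinearEquiv k).symm.toLinearMap ∘ₗ H.S.toLinearMap ∘ₗ H.s.toLinearMap)
    (by simp [H.counit_one])
    (fun x y => by
      simp only [LinearMap.comp_apply, AlgHom.toLinearMap_apply, AlgEquiv.toLinearMap_apply,
        LinearEquiv.coe_coe, coe_opLinearEquiv_symm, map_mul, unop_mul]
      -- Both `S` and `t` reverse products, so the order is restored; the counit is a left inverse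
      -- of `t`.
      rw [H.S_s x, H.S_s y, ← map_mul, ← op_mul]
      simp only [counit_t])

theorem nakayamaHom_apply (z : R) : H.nakayamaHom z = H.counit (unop (H.S (H.s z))) := rfl

/-- The twist of `z` determines `S(s(z))` by `S_s`, then `s(z)` by invertibility of `S`, then `z` by
the counit. -/
theorem nakayamaHom_injective : Function.Injective H.nakayamaHom := fun x y h => by
  have h' : unop (H.S (H.s x)) = unop (H.S (H.s y)) := by
    rw [H.S_s x, H.S_s y, ← nakayamaHom_apply, ← nakayamaHom_apply, h]
  rw [← H.counit_s x, ← H.counit_s y, H.S.injective (unop_injective h')]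

/-- The algebra automorphism `z ↦ counit (S (s z))` of `R`. -/
def nakayama [FiniteDimensional k R] : R ≃ₐ[k] R :=
  AlgEquiv.ofBijective H.nakayamaHom ⟨H.nakayamaHom_injective,
    LinearMap.surjective_of_injective (f := H.nakayamaHom.toLinearMap) H.nakayamaHom_injective⟩

/-- Here `S(s(z) t(x)) = s(x) t(θ z)` with `θ z = ε(S(s(z)))`. Commuting `t(θ z)` past `s(y)` and
taking the counit gives `x y θ(z)`. -/
theorem dualAct_s_mul_t (x z y : R) (f : Module.Dual k R) :
    H.dualAct (H.s z * H.t (op x)) f y = f (x * y * H.counit (unop (H.S (H.s z)))) := by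
  rw [dualAct_apply, map_mul H.S, unop_mul, H.S_t, H.S_s z, mul_assoc, ← (H.commute _ _).eq,
    ← mul_assoc, ← map_mul, H.counit_s_mul, H.counit_t]

theorem dualAct_s (z y : R) (f : Module.Dual k R) :
    H.dualAct (H.s z) f y = f (y * H.counit (unop (H.S (H.s z)))) := by
  simpa using H.dualAct_s_mul_t 1 z y f

theorem dualAct_t (x y : R) (f : Module.Dual k R) :
    H.dualAct (H.t (op x)) f y = f (x * y) := by
  simpa [H.counit_one] using H.dualAct_s_mul_t x 1 y f

variable [FiniteDimensional k R]

/-- Bimodule maps into the underlying bimodule of `dualFdMod` as bilinear forms. -/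
def forgetDualForms : AdjointForms (envelopingTwist H.nakayama) (finDimBimod k R).ι
    (H.forgetFd.obj H.dualFdMod) :=
  twistedDualForms H.nakayama _ (LinearEquiv.refl k (Module.Dual k R))
    (fun z f y => (congrArg (fun g : Module.Dual k R => g y) (H.lact_res H.dualMod z f)).trans
      (H.dualAct_s z y f))
    (fun x f y => (congrArg (fun g : Module.Dual k R => g y)
      (H.ract_res H.dualMod (op x) f)).trans (H.dualAct_t x y f))

/-- The monoidal structure maps are identities and both forms are evaluation at `1`, so a pairing
and its image have definitionally the same form; perfection carries over as is. -/
theorem isClosedFunctor_forgetFd : IsClosedFunctor H.forgetFd :=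
  H.dualForms.isClosedFunctor H.forgetFd H.forgetDualForms fun _ hp => hp

end FullHopfAlgebroid

theorem dualBimod_lact (z y : R) (f : Module.Dual k R) :
    (show Module.Dual k R from (dualBimod k R).lact z f) y = f (y * z) :=
  congrArg (fun g : Module.Dual k R => g y)
    (lact_ofActions (Module.Dual k R) _ _ _ z f)

theorem dualBimod_ract (x y : R) (f : Module.Dual k R) :
    (show Module.Dual k R from (dualBimod k R).ract (op x) f) y = f (x * y) :=
  congrArg (fun g : Module.Dual k R => g y)
    (ract_ofActions (Module.Dual k R) _ _ _ (op x) f)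

theorem isDualizing_dualFdBimod [FiniteDimensional k R] : IsDualizing (dualFdBimod k R) :=
  (twistedDualForms AlgEquiv.refl (dualFdBimod k R) (LinearEquiv.refl k (Module.Dual k R))
    (fun z f y => dualBimod_lact z y f)
    (fun x f y => dualBimod_ract x y f)).hasUniversalPairings.isDualizing

theorem FullHopfAlgebroid.forgetFd_dualFdMod_eq_iff [FiniteDimensional k R]
    (H : FullHopfAlgebroid k R B) :
    H.forgetFd.obj H.dualFdMod = dualFdBimod k R ↔
      ∀ z : R, H.counit (unop (H.S (H.s z))) = z := by
  constructor
  · intro h z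
    have h₁ : H.dualAct.comp H.e = (dualBimod k R).act :=
      AlgMod.act_eq_of_mk_eq (V := Module.Dual k R) (congrArg (fun X => X.obj) h)
    -- Functionals separate the points of `R`, so it suffices to compare the two left actions of `z`
    -- at `y = 1`.
    refine (Module.forall_dual_apply_eq_zero_iff k _).1 ?_ |> sub_eq_zero.1
    intro f
    have h₂ := H.dualAct_s z 1 f
    have h₃ := dualBimod_lact z 1 f
    have h₄ : H.dualAct (H.s z) f = (dualBimod k R).lact z f := by
      have := LinearMap.congr_fun (AlgHom.congr_fun h₁ (z ⊗ₜ 1)) f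
      refine Eq.trans ?_ this
      simp [SourceTarget.e]
    rw [map_sub, sub_eq_zero]
    rw [h₄] at h₂
    simpa using h₂.symm.trans h₃
  · intro h
    refine fullSubcategory_eq (congrArg
      (fun a => (⟨Module.Dual k R, a⟩ : RBimod k R)) (?_ : H.dualAct.comp H.e = (dualBimod k R).act))
    refine AlgHom.toLinearMap_injective (TensorProduct.ext' fun z x => LinearMap.ext fun f => ?_)
    obtain ⟨x, rfl⟩ := op_surjective x
    refine Eq.trans ?_ (RBimod.act_tmul (dualBimod k R) z (op x) f).symm
    refine LinearMap.ext fun y => ?_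
    refine Eq.trans ?_ (dualBimod_lact z y _).symm
    refine Eq.trans ?_ (dualBimod_ract x (y * z) f).symm
    have := H.dualAct_s_mul_t x z y f
    rw [h, mul_assoc] at this
    refine Eq.trans ?_ this
    simp [SourceTarget.e]

end

end HopfGV

end

theorem mainTheorem11 {k R B : Type u} [Field k] [Ring R] [Algebra k R] [FiniteDimensional k R]
    [Ring B] [Algebra k B] (H : HopfGV.FullHopfAlgebroid k R B) :
    HopfGV.IsDualizing H.dualFdMod ∧
    HopfGV.IsStrictMonoidal H.forgetFd ∧
    HopfGV.IsClosedFunctor H.forgetFd ∧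
    HopfGV.IsDualizing (H.forgetFd.obj H.dualFdMod) ∧
    (∀ (x z y : R) (f : Module.Dual k R),
      H.dualAct (H.s z * H.t (op x)) f y = f (x * y * H.counit (unop (H.S (H.s z))))) ∧
    HopfGV.IsDualizing (HopfGV.dualFdBimod k R) ∧
    (H.forgetFd.obj H.dualFdMod = HopfGV.dualFdBimod k R ↔
      ∀ z : R, H.counit (unop (H.S (H.s z))) = z) :=
  ⟨H.dualForms.hasUniversalPairings.isDualizing, H.isStrictMonoidal_forgetFd,
    H.isClosedFunctor_forgetFd, H.forgetDualForms.hasUniversalPairings.isDualizing,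
    H.dualAct_s_mul_t, HopfGV.isDualizing_dualFdBimod, H.forgetFd_dualFdMod_eq_iff⟩
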